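/- **Definitions.** A clause is an expression $H\leftarrow B$ with $H$ (head) and $B$ (body) finite sets of atoms; a CNF theory $\Pi$ is a finite set of clauses, and $\mathrm{atom}(\Pi)$ is the set of the atoms occurring in it. A clause with empty head is a constraint; $\Pi$ is positive if it has no constraint. A clause is disjunctive if $|H|>1$; $\Pi^{nd}$ is the set of the non-disjunctive clauses of $\Pi$. A clause is true in a set $I$ of atoms if $H\cap I\neq\emptyset$ or $B\not\subseteq I$. A model of $\Pi$ is a set $I\subseteq\mathrm{atom}(\Pi)$ in which all clauses of $\Pi$ are true; it is minimal if no proper subset of it is a model. For $Z\subseteq Y\subseteq\mathrm{atom}(\Pi)$, $Z$ is outbound in $Y$ for $\Pi$ if some clause $H\leftarrow B$ of $\Pi$ satisfies $H\cap Z\ne\emptyset$, $B\cap(Y\setminus Z)\neq\emptyset$, $B\cap Z=\emptyset$ and $H\cap(Y\setminus Z)=\emptyset$. A nonempty $Y\subseteq\mathrm{atom}(\Pi)$ is elementary for $\Pi$ if all its nonempty proper subsets are outbound in $Y$ for $\Pi$. $\Pi$ is head-elementary-set-free (HEF) if $|E\cap H|\le 1$ for every elementary set $E$ and every clause $H\leftarrow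 B$ of $\Pi$. For a set $X$ of atoms, $\Pi_{X}=\{(H\cap X)\leftarrow (B\cap X) : (H\leftarrow B)\in\Pi,\ H\cap X\neq\emptyset\}$ and $\Pi_{X\leftarrow}=\{(H\cap X)\leftarrow B : (H\leftarrow B)\in\Pi,\ H\cap X\neq\emptyset\}$. The steady set of $M$ is the least model $S$ of $(\Pi_{M\leftarrow})^{nd}$, computed by unit propagation. The simplified theory is $\Pi(M)=\{(H\leftarrow B)\in\Pi : H\cap S=\emptyset,\ B\subseteq M\}_{M\setminus S}$. **Algorithms.** * *Elementary subgraph* of a set $X$ for a non-disjunctive theory $T$: the directed graph with nodes $X$ obtained from the graph without arcs as follows: project $T$ on $X$; then repeatedly take all remaining clauses $h\leftarrow B$ whose body lies in one strongly connected component of the current graph, add the arcs $(b,h)$, $b\in B$, and remove these clauses, until there is no such clause. * *find_super-elementary_set*$(Q)$: start with $X=\mathrm{atom}(Q)$; while the elementary subgraph of $X$ for $Q^{nd}$ is not strongly connected, select a strongly connected component $C$ of it that no arc leaves, and replace $X$ by $X\setminus C$; return $X$. * $\xi_{\rm HEF}(\Pi,M)$: let $\mathcal E'=\emptyset$. Repeat: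 set $M:=M\setminus\mathcal E'$, compute the steady set $S$ of $M$, and let $\Delta=(M\setminus S)\setminus\mathrm{atom}(\Pi(M))$ if $M\setminus S\supsetneq\mathrm{atom}(\Pi(M))$; otherwise $\Delta=\{a\}$ for a selected $a\in(M\setminus S)\setminus\mathrm{atom}(\Pi(M)^{nd})$ if $M\setminus S\supsetneq\mathrm{atom}(\Pi(M)^{nd})$; otherwise $\Delta=\emptyset$; set $\mathcal E':=\mathcal E'\cup\Delta$; until $\Delta=\emptyset$. Then return $\mathcal E'\cup(M\setminus S)$ if $\Pi(M)$ is non-disjunctive, and $\mathcal E'\cup\textit{find\_super-elementary\_set}(\Pi(M))$ otherwise. * $\mathrm{GEA}_\xi(\Pi,M)$: remove the constraints from $\Pi$. Repeat: compute the steady set $S$ of $M$; if all clauses of $\Pi$ are true in $S$, return $S$; otherwise let $\mathcal E=\xi(\Pi,M)$; if $\mathcal E=\emptyset$, return $M$; otherwise set $M:=M\setminus\mathcal E$. Theories and sets are stored as lists. Running time is the number of elementary steps: each comparison of two atoms, each visit of a list cell and each round of a loop is one step. The size of $\Pi$ is its number of clauses plus its number of occurrences of atoms; the size of an input $(\Pi,M)$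 is the size of $\Pi$ plus the length of the list $M$. **Theorem.** There is a polynomial $p$ with the following properties, for every HEF CNF theory $\Pi$ and however the selections (of atoms and of components) in $\xi_{\rm HEF}$ are made. 1. (Model minimization.) For every model $M$ of $\Pi$, $\mathrm{GEA}_{\xi_{\rm HEF}}(\Pi,M)$ halts after at most $p(s)$ steps, where $s$ is the size of $(\Pi,M)$, and returns a minimal model of $\Pi$ contained in $M$. 2. (Minimal model checking.) For every model $M$ of $\Pi$, the algorithm that answers whether $\mathrm{GEA}_{\xi_{\rm HEF}}(\Pi,M)$ equals $M$ halts after at most $p(s)$ steps, where $s$ is the size of $(\Pi,M)$, and it answers "yes" if and only if $M$ is a minimal model of $\Pi$. 3. (Minimal model finding.) If $\Pi$ is moreover positive, the algorithm that computes $\mathrm{GEA}_{\xi_{\rm HEF}}(\Pi,\mathrm{atom}(\Pi))$ halts after at most $p(s)$ steps, where $s$ is the size of $\Pi$, and returns a minimal model of $\Pi$. -/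

import Mathlib

namespace CNFTheory

/-! ## CNF theories, models, head-elementary-set-free theories -/

/-- A clause `H ← B`: the pair `(H, B)` of its head and its body. -/
abbrev Clause (α : Type) := Finset α × Finset α

/-- A theory is a finite set of clauses. -/
abbrev Theory (α : Type) := Finset (Clause α)

section Semantics

variable {α : Type} [DecidableEq α]

/-- The set of the atoms occurring in a theory. -/
def atoms (P : Theory α) : Finset α := P.biUnion fun c => c.1 ∪ c.2

/-- `H ← B` is true in `I`: some head atom is true in `I` or some body atom is false in `I`. -/
def Clause.TrueIn (c : Clause α) (I : Finset α) : Prop :=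
  (∃ a ∈ c.1, a ∈ I) ∨ (∃ a ∈ c.2, a ∉ I)

/-- A model: a set of atoms of the theory in which all its clauses are true. -/
def IsModel (P : Theory α) (I : Finset α) : Prop :=
  I ⊆ atoms P ∧ ∀ c ∈ P, Clause.TrueIn c I

/-- A minimal model: a model no proper subset of which is a model. -/
def IsMinimalModel (P : Theory α) (M : Finset α) : Prop :=
  IsModel P M ∧ ∀ N, N ⊂ M → ¬ IsModel P N

/-- A theory is positive if it has no constraint, that is, no clause with an empty head. -/
def IsPositive (P : Theory α) : Prop := ∀ c ∈ P, c.1.Nonempty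

/-- The subset `Z` of `Y` is outbound in `Y` for `P`. -/
def Outbound (P : Theory α) (Y Z : Finset α) : Prop :=
  Z ⊆ Y ∧ ∃ c ∈ P, (c.1 ∩ Z).Nonempty ∧ (c.2 ∩ (Y \ Z)).Nonempty ∧
    c.2 ∩ Z = ∅ ∧ c.1 ∩ (Y \ Z) = ∅

/-- `Y` is an elementary set for `P`. -/
def Elementary (P : Theory α) (Y : Finset α) : Prop :=
  Y.Nonempty ∧ Y ⊆ atoms P ∧ ∀ Z, Z ⊂ Y → Z.Nonempty → Outbound P Y Z

/-- Head-elementary-set-free theories. -/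
def IsHEF (P : Theory α) : Prop :=
  ∀ c ∈ P, ¬ ∃ E, Elementary P E ∧ 1 < (E ∩ c.1).card

end Semantics

/-! ## Computations with a step count

A computation either diverges or returns a value after a number of steps. The programs below are
written with the operations of this section only, plus constructors, pattern matching on a bounded
number of cells, and Boolean connectives. The comparison of two atoms, the visit of a cell of a
list (the end of the list included), and each round of a `repeat` loop cost one step. -/

/-- A computation: undefined if it diverges, otherwise its value and its number of steps. -/
def Comp (β : Type) : Type := Part (β × ℕ)

namespace Comp

/-- The computation `x` halts, with value `b`, after exactly `n` steps. -/
def Returns {β : Type} (x : Comp β) (b : β) (n : ℕ) : Prop :=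
  (show Part (β × ℕ) from x) = Part.some (b, n)

/-- Return `b` after `n` steps. -/
def ret {β : Type} (b : β) (n : ℕ) : Comp β := Part.some (b, n)

/-- Sequential composition; the numbers of steps are added. -/
protected def bind {β γ : Type} (x : Comp β) (f : β → Comp γ) : Comp γ :=
  Part.bind (show Part (β × ℕ) from x) fun r =>
    Part.map (fun s : γ × ℕ => (s.1, r.2 + s.2)) (f r.1)

instance : Monad Comp where
  pure b := ret b 0
  bind := Comp.bind

/-- One step. -/
def tick : Comp Unit := ret () 1

/-- A `repeat` loop: the body maps the state to `Sum.inl b` to leave the loop with the value `b`,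
and to `Sum.inr s` to go on with the state `s`. A loop that is never left diverges. -/
noncomputable def repeatLoop {σ β : Type} (body : σ → Comp (β ⊕ σ)) (s : σ) : Comp β :=
  PFun.fix (fun t : σ × ℕ =>
    Part.map (fun r : (β ⊕ σ) × ℕ =>
      Sum.map (fun b : β => (b, t.2 + r.2 + 1)) (fun s' : σ => (s', t.2 + r.2 + 1)) r.1)
    (show Part ((β ⊕ σ) × ℕ) from body t.1)) (s, 0)

/-- Take from a nonempty list the entry with number `i` modulo its length; one step for each entry
of the list. There is no result on the empty list. -/
def select {β : Type} (i : ℕ) : List β → Comp β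
  | [] => (Part.none : Part (β × ℕ))
  | b :: l => ret ((b :: l).getD (i % (l.length + 1)) b) (l.length + 1)

def isEmpty {β : Type} : List β → Comp Bool
  | [] => ret true 1
  | _ :: _ => ret false 1

def append {β : Type} : List β → List β → Comp (List β)
  | [], k => do
    tick
    pure k
  | b :: l, k => do
    tick
    let r ← append l k
    pure (b :: r)

/-- Is there an entry that passes the test `p`? -/
def any {β : Type} (p : β → Comp Bool) : List β → Comp Bool
  | [] => do
    tick
    pure false
  | b :: l => do
    tick
    let r ← p b
    if r then pure true else any p l

/-- Do all entries pass the test `p`? -/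
def all {β : Type} (p : β → Comp Bool) : List β → Comp Bool
  | [] => do
    tick
    pure true
  | b :: l => do
    tick
    let r ← p b
    if r then all p l else pure false

/-- The list of the entries that pass the test `p`. -/
def filter {β : Type} (p : β → Comp Bool) : List β → Comp (List β)
  | [] => do
    tick
    pure []
  | b :: l => do
    tick
    let r ← p b
    let k ← filter p l
    pure (if r then b :: k else k)

/-- The concatenation of the lists computed by `f` from the entries. -/
def flatMap {β γ : Type} (f : β → Comp (List γ)) : List β → Comp (List γ)
  | [] => do
    tick
    pure []
  | b :: l => do
    tick
    let r ← f b
    let k ← flatMap f l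
    append r k

section Sets

variable {α : Type} [DecidableEq α]

/-- The comparison of two atoms. -/
def eqAtom (a b : α) : Comp Bool := ret (decide (a = b)) 1

/-! Finite sets of atoms are given by lists; order and repetitions do not matter. -/

def mem (a : α) (l : List α) : Comp Bool := any (eqAtom a) l

def notMem (a : α) (l : List α) : Comp Bool := do
  let r ← mem a l
  pure (!r)

def inter (l k : List α) : Comp (List α) := filter (fun a => mem a k) l

def diff (l k : List α) : Comp (List α) := filter (fun a => notMem a k) l

def subset (l k : List α) : Comp Bool := all (fun a => mem a k) l

/-- `l ⊃ k` (proper inclusion). -/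
def ssupset (l k : List α) : Comp Bool := do
  let r ← subset k l
  let s ← subset l k
  pure (r && !s)

def disjoint (l k : List α) : Comp Bool := all (fun a => notMem a k) l

/-- Does the list hold at most one atom (possibly repeated)? -/
def atMostOne : List α → Comp Bool
  | [] => ret true 1
  | a :: l => all (eqAtom a) l

/-- Does the list hold exactly one atom (possibly repeated)? -/
def exactlyOne : List α → Comp Bool
  | [] => ret false 1
  | a :: l => all (eqAtom a) l

end Sets

end Comp

/-! ## The algorithms -/

/-- A clause as an input of an algorithm: a list of its head atoms and a list of its body atoms. -/
abbrev ListClause (α : Type) := List α × List α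

/-- A theory as an input of an algorithm: a list of its clauses. -/
abbrev ListTheory (α : Type) := List (ListClause α)

/-- The theory given by a list of clauses. -/
def ListTheory.toTheory {α : Type} [DecidableEq α] (P : ListTheory α) : Theory α :=
  (P.map fun c => (c.1.toFinset, c.2.toFinset)).toFinset

/-- The size of a theory: the number of its clauses plus the number of occurrences of atoms. -/
def ListTheory.size {α : Type} (P : ListTheory α) : ℕ :=
  (P.map fun c => 1 + c.1.length + c.2.length).sum

section Algorithms

open CNFTheory.Comp

variable {α : Type} [DecidableEq α]

/-- The list of the atoms of a theory. -/
def computeAtoms (P : ListTheory α) : Comp (List α) :=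
  flatMap (fun c => append c.1 c.2) P

/-- Remove the constraints. -/
def removeConstraints (P : ListTheory α) : Comp (ListTheory α) :=
  filter (fun c => do
    let e ← isEmpty c.1
    pure (!e)) P

/-- Are all the clauses of `P` true in `I`? -/
def satisfies (P : ListTheory α) (I : List α) : Comp Bool :=
  all (fun c => do
    let h ← disjoint c.1 I
    let b ← subset c.2 I
    pure (!h || !b)) P

/-- The subtheory `P^nd` of the non-disjunctive clauses (at most one atom in the head). -/
def nonDisjunctivePart (P : ListTheory α) : Comp (ListTheory α) :=
  filter (fun c => atMostOne c.1) P

/-- Is `P` non-disjunctive? -/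
def isNonDisjunctive (P : ListTheory α) : Comp Bool :=
  all (fun c => atMostOne c.1) P

/-- The theory `P_X`: the clauses `H ∩ X ← B ∩ X` with `H ∩ X` nonempty. -/
def project (P : ListTheory α) (X : List α) : Comp (ListTheory α) :=
  flatMap (fun c => do
    let H ← inter c.1 X
    let B ← inter c.2 X
    let e ← isEmpty H
    pure (if e then [] else [(H, B)])) P

/-- The theory `(P_{X←})^nd`: the clauses `H ∩ X ← B` for which `H ∩ X` holds exactly one atom. -/
def headProjectNonDisjunctive (P : ListTheory α) (X : List α) : Comp (ListTheory α) :=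
  flatMap (fun c => do
    let H ← inter c.1 X
    let o ← exactlyOne H
    pure (if o then [(H, c.2)] else [])) P

/-- The least model of a theory all of whose clauses are single-head, by unit propagation: as long
as there are clauses that are false in the current set, add their head atoms. -/
noncomputable def leastModel (P : ListTheory α) : Comp (List α) :=
  repeatLoop (fun S : List α => do
    let N ← flatMap (fun c => do
      let h ← disjoint c.1 S
      let b ← subset c.2 S
      pure (if h && b then c.1 else [])) P
    let e ← isEmpty N
    let S' ← append N S
    pure (if e then Sum.inl S else Sum.inr S')) []

/-- The steady set of `M` for `P`: the minimal model of `(P_{M←})^nd`. -/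
noncomputable def steadySet (P : ListTheory α) (M : List α) : Comp (List α) := do
  let N ← headProjectNonDisjunctive P M
  leastModel N

/-- The simplified theory of `P` with respect to `M`, where `S` is the steady set: the clauses of
`P` whose head is disjoint from `S` and whose body is contained in `M`, projected on `M \ S`. -/
def simplify (P : ListTheory α) (M S : List α) : Comp (ListTheory α) := do
  let P' ← filter (fun c => do
    let h ← disjoint c.1 S
    let b ← subset c.2 M
    pure (h && b)) P
  let R ← diff M S
  project P' R

/-- The nodes that can be reached from the node `u` along the arcs in `E`. -/
noncomputable def reachable (E : List (α × α)) (u : α) : Comp (List α) :=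
  repeatLoop (fun R : List α => do
    let N ← flatMap (fun e : α × α => do
      let s ← mem e.1 R
      let t ← notMem e.2 R
      pure (if s && t then [e.2] else [])) E
    let e ← isEmpty N
    let R' ← append N R
    pure (if e then Sum.inl R else Sum.inr R')) [u]

/-- Are `u` and `v` in the same strongly connected component? -/
noncomputable def sameComponent (E : List (α × α)) (u v : α) : Comp Bool := do
  let U ← reachable E u
  let V ← reachable E v
  let r ← mem v U
  let s ← mem u V
  pure (r && s)

/-- Are all the nodes in the list in the same strongly connected component? -/
noncomputable def inOneComponent (E : List (α × α)) : List α → Comp Bool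
  | [] => ret true 1
  | u :: l => all (sameComponent E u) l

/-- The arcs of the elementary subgraph of `X` for the non-disjunctive theory `P`. The nodes are the
atoms in `X`, so the clauses are projected on `X` first. In each round, the arcs from the body atoms
to the head atom are added for all the remaining clauses whose body lies in one strongly connected
component of the current graph, and these clauses are removed. -/
noncomputable def elementarySubgraph (P : ListTheory α) (X : List α) : Comp (List (α × α)) := do
  let P' ← project P X
  repeatLoop (fun st : ListTheory α × List (α × α) => do
    let C ← filter (fun c => inOneComponent st.2 c.2) st.1
    let D ← filter (fun c => do
      let o ← inOneComponent st.2 c.2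
      pure (!o)) st.1
    let N ← flatMap (fun c : ListClause α =>
      flatMap (fun b => flatMap (fun h => pure [(b, h)]) c.1) c.2) C
    let e ← isEmpty C
    let E' ← append N st.2
    pure (if e then Sum.inl st.2 else Sum.inr (D, E'))) (P', [])

/-- The strongly connected components in the last level of the graph with nodes `X` and arcs `E`:
those that no arc leaves (isolated components are among them). A component is listed once for each
of its entries in `X`. -/
noncomputable def lastLevel (X : List α) (E : List (α × α)) : Comp (List (List α)) :=
  flatMap (fun u => do
    let K ← filter (sameComponent E u) X
    let t ← all (fun e : α × α => do
      let i ← mem e.1 K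
      let o ← mem e.2 K
      pure (!i || o)) E
    pure (if t then [K] else [])) X

/-- The function `find_super-elementary_set`. The component that is removed from the current set `X`
is selected by the rule `ρ`, from `X` and the components in the last level. -/
noncomputable def findSuperElementarySet (ρ : List α → List (List α) → ℕ) (P : ListTheory α) :
    Comp (List α) := do
  let X₀ ← computeAtoms P
  let N ← nonDisjunctivePart P
  repeatLoop (fun X : List α => do
    let E ← elementarySubgraph N X
    let s ← inOneComponent E X
    if s then pure (Sum.inl X)
    else do
      let L ← lastLevel X E
      let K ← select (ρ X L) L
      let X' ← diff X K
      pure (Sum.inr X')) X₀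

/-- How the free choices of the operator are made: the number, in the list of the candidates (its
last argument), of the candidate that is taken. The number is used modulo the length of the list, so
every pair of functions is a way to make the choices. The choices may depend on the current model
and, for the components, on the current set `X` as well. -/
structure ChoiceRules (α : Type) where
  atom : List α → List α → ℕ
  component : List α → List α → List (List α) → ℕ

/-- One round of the first loop of the operator `ξ_HEF`. The state is the pair of `M` and `E'`; the
values on leaving the loop are `M`, the steady set `S`, the simplified theory `Q`, and `E'`. -/
noncomputable def xiHEFRound (ρ : ChoiceRules α) (P : ListTheory α) (st : List α × List α) :
    Comp ((List α × List α × ListTheory α × List α) ⊕ (List α × List α)) := do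
  let M ← diff st.1 st.2
  let S ← steadySet P M
  let R ← diff M S
  let Q ← simplify P M S
  let A ← computeAtoms Q
  let N ← nonDisjunctivePart Q
  let B ← computeAtoms N
  let s ← ssupset R A
  let t ← ssupset R B
  let Δ ← (if s then diff R A
    else if t then do
      let L ← diff R B
      let a ← select (ρ.atom M L) L
      pure [a]
    else pure [])
  let E' ← append st.2 Δ
  let e ← isEmpty Δ
  pure (if e then Sum.inl (M, S, Q, E') else Sum.inr (M, E'))

/-- The eliminating operator `ξ_HEF`. -/
noncomputable def xiHEF (ρ : ChoiceRules α) (P : ListTheory α) (M₀ : List α) :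
    Comp (List α) := do
  let (M, S, Q, E') ← repeatLoop (xiHEFRound ρ P) (M₀, [])
  let n ← isNonDisjunctive Q
  let E'' ← (if n then diff M S else findSuperElementarySet (ρ.component M) Q)
  append E' E''

/-- The Generalized Elimination Algorithm with the operator `ξ`. -/
noncomputable def gea (ξ : ListTheory α → List α → Comp (List α)) (P₀ : ListTheory α)
    (M₀ : List α) : Comp (List α) := do
  let P ← removeConstraints P₀
  repeatLoop (fun M : List α => do
    let S ← steadySet P M
    let s ← satisfies P S
    if s then pure (Sum.inl S)
    else do
      let E ← ξ P M
      let e ← isEmpty E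
      if e then pure (Sum.inl M)
      else do
        let M' ← diff M E
        pure (Sum.inr M')) M₀

/-- Minimal model checking: is `M` the set that is returned on the input `P` and `M`? -/
noncomputable def checkMinimalModel (ρ : ChoiceRules α) (P : ListTheory α) (M : List α) :
    Comp Bool := do
  let R ← gea (xiHEF ρ) P M
  let r ← subset R M
  let s ← subset M R
  pure (r && s)

/-- Minimal model finding: start from the set of all the atoms of `P`. -/
noncomputable def findMinimalModel (ρ : ChoiceRules α) (P : ListTheory α) : Comp (List α) := do
  let M ← computeAtoms P
  gea (xiHEF ρ) P M

end Algorithms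

end CNFTheory

/-! Correctness rests on two facts. First, every model U contained in M includes the steady set S of
M: a clause with exactly one head atom in M and its body in U can only be made true in U by that
atom. Hence if S is a model, it is the least one inside M, so it is minimal; and if M is contained
in S, then M itself is minimal (`IsSteady.subset_model`).

Second, whatever ξ_HEF removes from a model leaves a model. Write Q for the simplified theory.
Clauses whose head meets S remain true as long as S is kept (`sat_of_active`), so only clauses with
head disjoint from S matter. An atom of M \ S outside atom(Q) is in the head of no such clause with
body in M. An atom outside atom(Q^nd) is never the only head atom left in M. If Q is
non-disjunctive, unit propagation makes S a model. Otherwise a super-elementary set X is removed: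
every clause of Q^nd with head in X has a body atom in X, and every nonempty proper subset of X is
outbound by a clause of Q^nd. The second property makes X elementary for Π, so by the HEF hypothesis
no clause has two head atoms in X. A clause falsified by removing X would have all its head atoms of
M in X, hence exactly one; its projection would then be in Q^nd and its body would meet X, a
contradiction (`sat_diff_superElementary`).

The set X is found because deleting a component that no arc leaves preserves support in X, and
strong connectivity of the elementary subgraph gives outboundness: if Z is not outbound, every arc
into Z starts in Z (`findSuperElementarySet_spec`).

For the running time, each operation gets an explicit bound in terms of a common upper bound n of
the input sizes, so no monotonicity of cost functions is needed. Loops are bounded by decreasing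
measures. Lists may contain repetitions, so steady sets, arc lists and eliminated sets are only
bounded quadratically. All the bounds are built from n and constants by sums and products. -/

namespace CNFTheory

namespace Comp

/-- The computation `x` halts after at most `n` steps with a value that satisfies `Q`. -/
def Spec {β : Type} (x : Comp β) (n : ℕ) (Q : β → Prop) : Prop :=
  ∃ b m, x.Returns b m ∧ m ≤ n ∧ Q b

/-- The computation `x` decides `φ` in at most `n` steps. -/
abbrev Decides (x : Comp Bool) (n : ℕ) (φ : Prop) : Prop :=
  Spec x n fun r => r = true ↔ φ

/-! ### Rules for total correctness with a step bound -/

section Rules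

variable {β γ σ : Type}

theorem Spec.mono {x : Comp β} {n m : ℕ} {Q R : β → Prop} (h : Spec x n Q) (hnm : n ≤ m)
    (hQR : ∀ b, Q b → R b) : Spec x m R := by
  obtain ⟨b, k, hx, hk, hb⟩ := h
  exact ⟨b, k, hx, hk.trans hnm, hQR b hb⟩

theorem Spec.le {x : Comp β} {n m : ℕ} {Q : β → Prop} (h : Spec x n Q) (hnm : n ≤ m) :
    Spec x m Q := h.mono hnm fun _ => id

theorem Spec.imp {x : Comp β} {n : ℕ} {Q R : β → Prop} (h : Spec x n Q)
    (hQR : ∀ b, Q b → R b) : Spec x n R := h.mono le_rfl hQR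

theorem Spec.ret {b : β} {n m : ℕ} {Q : β → Prop} (hnm : n ≤ m) (hb : Q b) :
    Spec (Comp.ret b n) m Q := ⟨b, n, rfl, hnm, hb⟩

theorem Spec.pure {b : β} {m : ℕ} {Q : β → Prop} (hb : Q b) :
    Spec (Pure.pure b : Comp β) m Q := ⟨b, 0, rfl, Nat.zero_le _, hb⟩

theorem Spec.bind {x : Comp β} {f : β → Comp γ} {n m k : ℕ} {Q : β → Prop} {R : γ → Prop}
    (hx : Spec x n Q) (hf : ∀ b, Q b → Spec (f b) m R) (hk : n + m ≤ k) :
    Spec (x >>= f) k R := by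
  obtain ⟨b, i, hxb, hi, hb⟩ := hx
  obtain ⟨c, j, hfc, hj, hc⟩ := hf b hb
  refine ⟨c, i + j, ?_, by omega, hc⟩
  change Comp.bind x f = Part.some (c, i + j)
  unfold Comp.bind
  change x = Part.some (b, i) at hxb
  change f b = Part.some (c, j) at hfc
  rw [hxb, Part.bind_some]
  dsimp only
  rw [hfc, Part.map_some]

theorem Spec.tick_bind {f : Unit → Comp γ} {m k : ℕ} {R : γ → Prop}
    (hf : Spec (f ()) m R) (hk : m + 1 ≤ k) : Spec (tick >>= f) k R :=
  Spec.bind (Q := fun _ => True) (n := 1) (Spec.ret le_rfl trivial) (fun _ _ => hf) (by omega)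

/-- Each round that does not leave the loop lowers the measure, so there are at most k + 1 rounds;
each costs at most c, plus one step for the round itself. -/
theorem Spec.repeatLoop {body : σ → Comp (β ⊕ σ)} {Post : β → Prop} (Inv : σ → Prop) (μ : σ → ℕ)
    (c : ℕ)
    (hbody : ∀ s, Inv s → Spec (body s) c (Sum.elim Post fun s' => Inv s' ∧ μ s' < μ s))
    {s : σ} (hs : Inv s) {k m : ℕ} (hk : μ s ≤ k) (hm : (k + 1) * (c + 1) ≤ m) :
    Spec (Comp.repeatLoop body s) m Post := by
  -- The functional of the fixed point is kept opaque, and only its behaviour on the two kinds of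
  -- outcome is used. The second component t of its state is the number of steps spent so far, so it
  -- has to be general in the induction on k.
  suffices H : ∀ F : σ × ℕ →. (β × ℕ) ⊕ (σ × ℕ),
      (∀ s t b i, (body s).Returns (Sum.inl b) i → Sum.inl (b, t + i + 1) ∈ F (s, t)) →
      (∀ s t s' i, (body s).Returns (Sum.inr s') i → Sum.inr (s', t + i + 1) ∈ F (s, t)) →
      ∀ k s t, Inv s → μ s ≤ k → ∃ b n,
        (b, t + n) ∈ PFun.fix F (s, t) ∧ n ≤ (k + 1) * (c + 1) ∧ Post b by
    obtain ⟨b, n, hb, hn, hp⟩ := H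
      (fun t : σ × ℕ =>
        Part.map (fun r : (β ⊕ σ) × ℕ =>
          Sum.map (fun b : β => (b, t.2 + r.2 + 1)) (fun s' : σ => (s', t.2 + r.2 + 1)) r.1)
        (show Part ((β ⊕ σ) × ℕ) from body t.1))
      (fun s t b i h => (Part.mem_map_iff _).2 ⟨(Sum.inl b, i), Part.eq_some_iff.1 h, rfl⟩)
      (fun s t s' i h => (Part.mem_map_iff _).2 ⟨(Sum.inr s', i), Part.eq_some_iff.1 h, rfl⟩)
      k s 0 hs hk
    refine ⟨b, n, ?_, hn.trans hm, hp⟩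
    rw [Nat.zero_add] at hb
    exact Part.eq_some_iff.2 hb
  clear hs hk hm s k m
  intro F hl hr k
  induction k with
  | zero =>
    intro s t hs hk
    obtain ⟨r, i, h, hi, hQ⟩ := hbody s hs
    rcases r with b | s'
    · exact ⟨b, i + 1, PFun.mem_fix_iff.2 (Or.inl (hl s t b i h)), by omega, hQ⟩
    · have := hQ.2
      omega
  | succ k ih =>
    intro s t hs hk
    obtain ⟨r, i, h, hi, hQ⟩ := hbody s hs
    rcases r with b | s'
    · exact ⟨b, i + 1, PFun.mem_fix_iff.2 (Or.inl (hl s t b i h)), by nlinarith, hQ⟩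
    · obtain ⟨hI, hlt⟩ := hQ
      obtain ⟨b, n, hb, hn, hp⟩ := ih s' (t + i + 1) hI (by omega)
      refine ⟨b, i + 1 + n, PFun.mem_fix_iff.2 (Or.inr ⟨_, hr s t s' i h, ?_⟩), by nlinarith, hp⟩
      convert hb using 2
      omega

end Rules

/-! ### Costs of the list operations -/

section Lists

variable {β γ : Type}

theorem isEmpty_spec (l : List β) : Decides (isEmpty l) 1 (l = []) := by
  cases l
  · exact Spec.ret le_rfl (by simp)
  · exact Spec.ret le_rfl (by simp)

theorem append_spec (l k : List β) : Spec (append l k) (l.length + 1) (· = l ++ k) := by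
  induction l with
  | nil => exact Spec.tick_bind (m := 0) (Spec.pure rfl) (by simp)
  | cons b l ih =>
    refine Spec.tick_bind (m := l.length + 1) ?_ (by simp)
    refine Spec.bind (m := 0) ih ?_ (by simp)
    rintro _ rfl
    exact Spec.pure rfl

theorem any_spec {p : β → Comp Bool} {φ : β → Prop} {c n : ℕ} {l : List β} (hl : l.length ≤ n)
    (h : ∀ b ∈ l, Decides (p b) c (φ b)) :
    Decides (any p l) (n * (c + 1) + 1) (∃ b ∈ l, φ b) := by
  induction l generalizing n with
  | nil => exact Spec.tick_bind (m := 0) (Spec.pure (by simp)) (by omega)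
  | cons b l ih =>
    obtain ⟨n, rfl⟩ : ∃ n', n = n' + 1 := ⟨n - 1, by simp at hl; omega⟩
    refine Spec.tick_bind (m := c + (n * (c + 1) + 1)) ?_ (by ring_nf; omega)
    refine Spec.bind (h b (by simp)) ?_ le_rfl
    intro r hr
    cases r
    · refine (ih (by simpa using hl) fun b hb => h b (by simp [hb])).imp fun r hr' => ?_
      have : ¬ φ b := by simpa using hr
      simp [hr', this]
    · have : φ b := by simpa using hr
      exact Spec.pure (by simp [this])

theorem all_spec {p : β → Comp Bool} {φ : β → Prop} {c n : ℕ} {l : List β} (hl : l.length ≤ n)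
    (h : ∀ b ∈ l, Decides (p b) c (φ b)) :
    Decides (all p l) (n * (c + 1) + 1) (∀ b ∈ l, φ b) := by
  induction l generalizing n with
  | nil => exact Spec.tick_bind (m := 0) (Spec.pure (by simp)) (by omega)
  | cons b l ih =>
    obtain ⟨n, rfl⟩ : ∃ n', n = n' + 1 := ⟨n - 1, by simp at hl; omega⟩
    refine Spec.tick_bind (m := c + (n * (c + 1) + 1)) ?_ (by ring_nf; omega)
    refine Spec.bind (h b (by simp)) ?_ le_rfl
    intro r hr
    cases r
    · have : ¬ φ b := by simpa using hr
      exact Spec.pure (by simp [this])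
    · have : φ b := by simpa using hr
      refine (ih (by simpa using hl) fun b hb => h b (by simp [hb])).imp fun r hr' => ?_
      simp [hr', this]

theorem filter_spec {p : β → Comp Bool} {φ : β → Prop} [DecidablePred φ] {c n : ℕ} {l : List β}
    (hl : l.length ≤ n) (h : ∀ b ∈ l, Decides (p b) c (φ b)) :
    Spec (filter p l) (n * (c + 1) + 1) (· = l.filter fun b => φ b) := by
  induction l generalizing n with
  | nil => exact Spec.tick_bind (m := 0) (Spec.pure (by simp)) (by omega)
  | cons b l ih =>
    obtain ⟨n, rfl⟩ : ∃ n', n = n' + 1 := ⟨n - 1, by simp at hl; omega⟩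
    refine Spec.tick_bind (m := c + (n * (c + 1) + 1)) ?_ (by ring_nf; omega)
    refine Spec.bind (h b (by simp)) ?_ le_rfl
    intro r hr
    refine Spec.bind (m := 0) (ih (by simpa using hl) fun b hb => h b (by simp [hb])) ?_ le_rfl
    rintro _ rfl
    refine Spec.pure ?_
    cases r
    · have : ¬ φ b := by simpa using hr
      simp [this]
    · have : φ b := by simpa using hr
      simp [this]

/-- An entry costs its visit, the computation of `g b` and the final `append`, which visits at most
L cells and the end of the list: 1 + c + (L + 1). -/
theorem flatMap_spec {f : β → Comp (List γ)} {g : β → List γ} {c L n : ℕ} {l : List β}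
    (hl : l.length ≤ n) (h : ∀ b ∈ l, Spec (f b) c (· = g b)) (hL : ∀ b ∈ l, (g b).length ≤ L) :
    Spec (flatMap f l) (n * (c + L + 2) + 1) (· = l.flatMap g) := by
  induction l generalizing n with
  | nil => exact Spec.tick_bind (m := 0) (Spec.pure (by simp)) (by omega)
  | cons b l ih =>
    obtain ⟨n, rfl⟩ : ∃ n', n = n' + 1 := ⟨n - 1, by simp at hl; omega⟩
    refine Spec.tick_bind (m := c + ((n * (c + L + 2) + 1) + (L + 1))) ?_ (by ring_nf; omega)
    refine Spec.bind (h b (by simp)) ?_ le_rfl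
    rintro _ rfl
    refine Spec.bind (ih (by simpa using hl) (fun b hb => h b (by simp [hb]))
      fun b hb => hL b (by simp [hb])) ?_ le_rfl
    rintro _ rfl
    refine (append_spec _ _).mono (by have := hL b (by simp); omega) ?_
    rintro _ rfl
    simp

theorem select_spec (i : ℕ) {l : List β} {n : ℕ} (hl : l ≠ []) (hn : l.length ≤ n) :
    Spec (select i l) n (· ∈ l) := by
  cases l with
  | nil => exact absurd rfl hl
  | cons b l =>
    refine Spec.ret (by simpa using hn) ?_
    have : i % (l.length + 1) < (b :: l).length := by simpa using Nat.mod_lt _ (Nat.succ_pos _)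
    rw [List.getD_eq_getElem _ _ this]
    exact List.getElem_mem _

end Lists

/-! ### Costs of the set operations -/

section Sets

variable {α : Type} [DecidableEq α]

theorem mem_spec (a : α) {l : List α} {n : ℕ} (hl : l.length ≤ n) :
    Decides (mem a l) (2 * n + 1) (a ∈ l) := by
  refine (any_spec (c := 1) (φ := fun b => a = b) hl fun b _ => Spec.ret le_rfl (by simp)).mono
    (by omega) fun r hr => ?_
  simp [hr]

theorem notMem_spec (a : α) {l : List α} {n : ℕ} (hl : l.length ≤ n) :
    Decides (notMem a l) (2 * n + 1) (a ∉ l) := by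
  refine Spec.bind (m := 0) (mem_spec a hl) ?_ le_rfl
  intro r hr
  exact Spec.pure (by rw [← hr]; simp)

/-- The cost of the operations on two sets. -/
def setCost (n m : ℕ) : ℕ := n * (2 * m + 2) + 1

variable {l k : List α} {n m : ℕ}

theorem inter_spec (hl : l.length ≤ n) (hk : k.length ≤ m) :
    Spec (inter l k) (setCost n m) (· = l.filter (· ∈ k)) :=
  filter_spec hl fun b _ => mem_spec b hk

theorem diff_spec (hl : l.length ≤ n) (hk : k.length ≤ m) :
    Spec (diff l k) (setCost n m) (· = l.filter (· ∉ k)) :=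
  filter_spec hl fun b _ => notMem_spec b hk

theorem subset_spec (hl : l.length ≤ n) (hk : k.length ≤ m) :
    Decides (subset l k) (setCost n m) (∀ a ∈ l, a ∈ k) :=
  all_spec hl fun b _ => mem_spec b hk

theorem disjoint_spec (hl : l.length ≤ n) (hk : k.length ≤ m) :
    Decides (disjoint l k) (setCost n m) (∀ a ∈ l, a ∉ k) :=
  all_spec hl fun b _ => notMem_spec b hk

theorem ssupset_spec (hl : l.length ≤ n) (hk : k.length ≤ m) :
    Decides (ssupset l k) (setCost m n + setCost n m) ((∀ a ∈ k, a ∈ l) ∧ ¬ ∀ a ∈ l, a ∈ k) := by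
  refine Spec.bind (subset_spec hk hl) (fun r hr => ?_) le_rfl
  refine Spec.bind (m := 0) (subset_spec hl hk) (fun s hs => ?_) le_rfl
  refine Spec.pure ?_
  rw [← hr, ← hs]
  simp

theorem atMostOne_spec (hl : l.length ≤ n) :
    Decides (atMostOne l) (2 * n + 1) (∀ a ∈ l, ∀ b ∈ l, a = b) := by
  cases l with
  | nil => exact Spec.ret (by omega) (by simp)
  | cons a l =>
    refine (all_spec (c := 1) (n := n) (φ := fun b => a = b) (by simp at hl; omega) fun b _ =>
      Spec.ret le_rfl (by simp)).mono (by omega) fun r hr => ?_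
    rw [hr]
    constructor
    · intro h x hx y hy
      have : ∀ z ∈ a :: l, z = a := by
        intro z hz
        rcases List.mem_cons.1 hz with rfl | hz
        · rfl
        · exact (h z hz).symm
      rw [this x hx, this y hy]
    · intro h b hb
      exact h a (by simp) b (by simp [hb])

theorem exactlyOne_spec (hl : l.length ≤ n) :
    Decides (exactlyOne l) (2 * n + 1) (l ≠ [] ∧ ∀ a ∈ l, ∀ b ∈ l, a = b) := by
  cases l with
  | nil => exact Spec.ret (by omega) (by simp)
  | cons a l =>
    refine (atMostOne_spec hl).imp fun r hr => ?_
    rw [hr]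
    simp

end Sets

end Comp

open CNFTheory.Comp

/-! ### Sizes of theories -/

section Sizes

variable {α : Type}

theorem size_cons (c : ListClause α) (P : ListTheory α) :
    ListTheory.size (c :: P) = 1 + c.1.length + c.2.length + ListTheory.size P := by
  simp [ListTheory.size]

theorem size_append (P Q : ListTheory α) :
    ListTheory.size (P ++ Q) = ListTheory.size P + ListTheory.size Q := by
  simp [ListTheory.size]

theorem length_le_size (P : ListTheory α) : P.length ≤ P.size := by
  induction P with
  | nil => simp
  | cons c P ih => rw [size_cons, List.length_cons]; omega

theorem clause_length_le_size {P : ListTheory α} {c : ListClause α} (hc : c ∈ P) :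
    c.1.length + c.2.length ≤ P.size := by
  induction P with
  | nil => simp at hc
  | cons d P ih =>
    rw [size_cons]
    rcases List.mem_cons.1 hc with rfl | h
    · omega
    · have := ih h
      omega

theorem size_filter_le (P : ListTheory α) (p : ListClause α → Bool) :
    ListTheory.size (P.filter p) ≤ P.size := by
  induction P with
  | nil => simp
  | cons d P ih =>
    rw [size_cons, List.filter_cons]
    split_ifs
    · rw [size_cons]; omega
    · omega

theorem size_flatMap_le (P : ListTheory α) (g : ListClause α → ListTheory α)
    (h : ∀ c ∈ P, (g c).size ≤ 1 + c.1.length + c.2.length) :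
    ListTheory.size (P.flatMap g) ≤ P.size := by
  induction P with
  | nil => simp
  | cons d P ih =>
    rw [size_cons, List.flatMap_cons, size_append]
    have := ih fun c hc => h c (by simp [hc])
    have := h d (by simp)
    omega

/-- The list of the atoms of a theory. -/
def atomList (P : ListTheory α) : List α := P.flatMap fun c => c.1 ++ c.2

theorem mem_atomList {P : ListTheory α} {a : α} :
    a ∈ atomList P ↔ ∃ c ∈ P, a ∈ c.1 ∨ a ∈ c.2 := by
  simp only [atomList, List.mem_flatMap, List.mem_append]

theorem length_atomList_le (P : ListTheory α) : (atomList P).length ≤ P.size := by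
  induction P with
  | nil => simp [atomList]
  | cons d P ih =>
    rw [size_cons, atomList, List.flatMap_cons, List.length_append, List.length_append]
    simp only [atomList] at ih
    omega

end Sizes

/-! ### Models and steady sets -/

section Semantics

variable {α : Type}

/-- All clauses of the theory are true in `I`. -/
def Sat (P : ListTheory α) (I : Set α) : Prop :=
  ∀ c ∈ P, (∀ b ∈ c.2, b ∈ I) → ∃ a ∈ c.1, a ∈ I

/-- `S` is the steady set of `M` for `P`: the least set that is closed under the clauses with
exactly one head atom in `M`. -/
structure IsSteady (P : ListTheory α) (M S : List α) : Prop where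
  closed : ∀ c ∈ P, ∀ h ∈ c.1, h ∈ M → (∀ x ∈ c.1, x ∈ M → x = h) → (∀ b ∈ c.2, b ∈ S) → h ∈ S
  least : ∀ U : Set α, (∀ c ∈ P, ∀ h ∈ c.1, h ∈ M → (∀ x ∈ c.1, x ∈ M → x = h) →
    (∀ b ∈ c.2, b ∈ U) → h ∈ U) → ∀ a ∈ S, a ∈ U

theorem IsSteady.subset {P : ListTheory α} {M S : List α} (h : IsSteady P M S) :
    ∀ a ∈ S, a ∈ M :=
  h.least {a | a ∈ M} fun _ _ _ _ hM _ _ => hM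

/-- A clause with a unique head atom in M must be satisfied in U by this atom, because U lies in M.
So U is closed under the propagation that generates S. All minimality claims come from here. -/
theorem IsSteady.subset_model {P : ListTheory α} {M S : List α} (h : IsSteady P M S) {U : Set α}
    (hU : Sat P U) (hUM : ∀ a ∈ U, a ∈ M) : ∀ a ∈ S, a ∈ U := by
  refine h.least U fun c hc x hx _ hu hb => ?_
  obtain ⟨a, ha, haU⟩ := hU c hc hb
  rwa [← hu a ha (hUM a haU)]

/-- Separates truth of the clauses from the requirement that only atoms of the theory occur; the
latter passes to subsets, so the algorithms are analysed with `Sat` alone. -/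
theorem isModel_iff [DecidableEq α] {P : ListTheory α} {I : Finset α} :
    IsModel P.toTheory I ↔ (∀ a ∈ I, a ∈ atomList P) ∧ Sat P (I : Set α) := by
  unfold IsModel
  refine and_congr ?_ ?_
  · simp only [Finset.subset_iff, atoms, ListTheory.toTheory, Finset.mem_biUnion, mem_atomList,
      List.mem_toFinset, List.mem_map, Finset.mem_union]
    refine forall_congr' fun a => imp_congr_right fun _ => ?_
    constructor
    · rintro ⟨_, ⟨c, hc, rfl⟩, h⟩
      exact ⟨c, hc, by simpa using h⟩
    · rintro ⟨c, hc, h⟩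
      exact ⟨_, ⟨c, hc, rfl⟩, by simpa using h⟩
  · simp only [Sat, ListTheory.toTheory, List.mem_toFinset, List.mem_map, Clause.TrueIn]
    constructor
    · intro h c hc hb
      rcases h _ ⟨c, hc, rfl⟩ with ⟨a, ha, haI⟩ | ⟨a, ha, haI⟩
      · exact ⟨a, by simpa using ha, haI⟩
      · exact absurd (hb a (by simpa using ha)) haI
    · rintro h _ ⟨c, hc, rfl⟩
      by_cases hb : ∀ b ∈ c.2, b ∈ (I : Set α)
      · obtain ⟨a, ha, haI⟩ := h c hc hb
        exact Or.inl ⟨a, by simpa using ha, haI⟩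
      · push Not at hb
        obtain ⟨b, hb, hbI⟩ := hb
        exact Or.inr ⟨b, by simpa using hb, hbI⟩

end Semantics

/-! ### Evaluation, projection and simplification of theories -/

section Projections

variable {α : Type}

theorem computeAtoms_spec {P : ListTheory α} {n : ℕ} (hP : P.size ≤ n) :
    Spec (computeAtoms P) (n * (n + 1 + n + 2) + 1) (· = atomList P) := by
  refine flatMap_spec ((length_le_size P).trans hP) (fun c hc => ?_) fun c hc => ?_
  · exact (append_spec _ _).le (by have := clause_length_le_size hc; omega)
  · have := clause_length_le_size hc
    rw [List.length_append]
    omega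

theorem removeConstraints_spec {P : ListTheory α} {n : ℕ} (hP : P.size ≤ n) :
    Spec (removeConstraints P) (n * 2 + 1) (· = P.filter fun c => c.1 ≠ []) := by
  refine filter_spec (c := 1) ((length_le_size P).trans hP) fun c _ => ?_
  refine Spec.bind (m := 0) (isEmpty_spec c.1) (fun e he => Spec.pure ?_) le_rfl
  rw [ne_eq, ← he]
  simp

variable [DecidableEq α]

/-- The cost of the evaluation of a theory in a set. -/
def satisfiesCost (n m : ℕ) : ℕ := n * (setCost n m + setCost n m + 1) + 1

theorem satisfies_spec {P : ListTheory α} {I : List α} {n m : ℕ} (hP : P.size ≤ n)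
    (hI : I.length ≤ m) : Decides (satisfies P I) (satisfiesCost n m) (Sat P {a | a ∈ I}) := by
  refine all_spec (φ := fun c : ListClause α => (∀ b ∈ c.2, b ∈ I) → ∃ a ∈ c.1, a ∈ I)
    ((length_le_size P).trans hP) fun c hc => ?_
  have := clause_length_le_size hc
  refine Spec.bind (disjoint_spec (by omega) hI) (fun r hr => ?_) le_rfl
  refine Spec.bind (m := 0) (subset_spec (by omega) hI) (fun s hs => Spec.pure ?_) le_rfl
  rw [← hs, show (∃ a ∈ c.1, a ∈ I) ↔ ¬ ∀ a ∈ c.1, a ∉ I by push Not; rfl, ← hr]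
  cases r <;> cases s <;> simp

/-- The non-disjunctive clauses. -/
def nonDisjunctiveList (P : ListTheory α) : ListTheory α :=
  P.filter fun c => ∀ a ∈ c.1, ∀ b ∈ c.1, a = b

theorem nonDisjunctivePart_spec {P : ListTheory α} {n : ℕ} (hP : P.size ≤ n) :
    Spec (nonDisjunctivePart P) (n * (2 * n + 2) + 1) (· = nonDisjunctiveList P) :=
  filter_spec ((length_le_size P).trans hP) fun c hc =>
    atMostOne_spec (by have := clause_length_le_size hc; omega)

theorem isNonDisjunctive_spec {P : ListTheory α} {n : ℕ} (hP : P.size ≤ n) :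
    Decides (isNonDisjunctive P) (n * (2 * n + 2) + 1)
      (∀ c ∈ P, ∀ a ∈ c.1, ∀ b ∈ c.1, a = b) :=
  all_spec ((length_le_size P).trans hP) fun c hc =>
    atMostOne_spec (by have := clause_length_le_size hc; omega)

/-- The projection of a theory on a set. -/
def projectList (P : ListTheory α) (X : List α) : ListTheory α :=
  P.flatMap fun c => if c.1.filter (· ∈ X) = [] then []
    else [(c.1.filter (· ∈ X), c.2.filter (· ∈ X))]

theorem mem_projectList {P : ListTheory α} {X : List α} {q : ListClause α} :
    q ∈ projectList P X ↔ ∃ c ∈ P, (∃ a ∈ c.1, a ∈ X) ∧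
      q = (c.1.filter (· ∈ X), c.2.filter (· ∈ X)) := by
  unfold projectList
  rw [List.mem_flatMap]
  refine exists_congr fun c => and_congr_right fun _ => ?_
  split_ifs with h
  · simp only [List.filter_eq_nil_iff, decide_eq_true_eq] at h
    simp only [List.not_mem_nil, false_iff]
    rintro ⟨⟨a, ha, haX⟩, _⟩
    exact h a ha haX
  · simp only [List.filter_eq_nil_iff, decide_eq_true_eq] at h
    push Not at h
    simp [h]

theorem size_projectList_le (P : ListTheory α) (X : List α) :
    (projectList P X).size ≤ P.size := by
  refine size_flatMap_le _ _ fun c _ => ?_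
  split_ifs
  · simp [ListTheory.size]
  · have := List.length_filter_le (· ∈ X) c.1
    have := List.length_filter_le (· ∈ X) c.2
    simp only [ListTheory.size, List.map_cons, List.map_nil, List.sum_cons, List.sum_nil]
    omega

/-- The cost of a projection. -/
def projectCost (n m : ℕ) : ℕ := n * (setCost n m + (setCost n m + 1) + 1 + 2) + 1

theorem project_spec {P : ListTheory α} {X : List α} {n m : ℕ} (hP : P.size ≤ n)
    (hX : X.length ≤ m) : Spec (project P X) (projectCost n m) (· = projectList P X) := by
  refine flatMap_spec ((length_le_size P).trans hP) (fun c hc => ?_) fun c hc => ?_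
  · have := clause_length_le_size hc
    refine Spec.bind (inter_spec (by omega) hX) ?_ le_rfl
    rintro _ rfl
    refine Spec.bind (inter_spec (by omega) hX) ?_ le_rfl
    rintro _ rfl
    refine Spec.bind (m := 0) (isEmpty_spec _) (fun e he => Spec.pure ?_) le_rfl
    simp only [he]
  · split_ifs <;> simp

/-- The clauses with exactly one head atom in `X`, with the other head atoms removed. -/
def headProjectList (P : ListTheory α) (X : List α) : ListTheory α :=
  P.flatMap fun c => if c.1.filter (· ∈ X) ≠ [] ∧
      ∀ a ∈ c.1.filter (· ∈ X), ∀ b ∈ c.1.filter (· ∈ X), a = b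
    then [(c.1.filter (· ∈ X), c.2)] else []

theorem mem_headProjectList {P : ListTheory α} {X : List α} {q : ListClause α} :
    q ∈ headProjectList P X ↔ ∃ c ∈ P, (∃ h ∈ c.1, h ∈ X ∧ ∀ x ∈ c.1, x ∈ X → x = h) ∧
      q = (c.1.filter (· ∈ X), c.2) := by
  unfold headProjectList
  rw [List.mem_flatMap]
  refine exists_congr fun c => and_congr_right fun _ => ?_
  have key : (c.1.filter (· ∈ X) ≠ [] ∧
      ∀ a ∈ c.1.filter (· ∈ X), ∀ b ∈ c.1.filter (· ∈ X), a = b) ↔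
      ∃ h ∈ c.1, h ∈ X ∧ ∀ x ∈ c.1, x ∈ X → x = h := by
    simp only [ne_eq, List.filter_eq_nil_iff, decide_eq_true_eq, List.mem_filter]
    push Not
    constructor
    · rintro ⟨⟨a, ha, haX⟩, h⟩
      exact ⟨a, ha, haX, fun x hx hxX => h x ⟨hx, hxX⟩ a ⟨ha, haX⟩⟩
    · rintro ⟨a, ha, haX, h⟩
      exact ⟨⟨a, ha, haX⟩, fun x hx y hy => (h x hx.1 hx.2).trans (h y hy.1 hy.2).symm⟩
  rw [← key]
  split_ifs with h
  · rw [List.mem_singleton]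
    exact ⟨fun hq => ⟨h, hq⟩, fun hq => hq.2⟩
  · exact ⟨fun hq => absurd hq (by simp), fun hq => absurd hq.1 h⟩

theorem size_headProjectList_le (P : ListTheory α) (X : List α) :
    (headProjectList P X).size ≤ P.size := by
  refine size_flatMap_le _ _ fun c _ => ?_
  split_ifs
  · have := List.length_filter_le (· ∈ X) c.1
    simp only [ListTheory.size, List.map_cons, List.map_nil, List.sum_cons, List.sum_nil]
    omega
  · simp [ListTheory.size]

theorem headProjectNonDisjunctive_spec {P : ListTheory α} {X : List α} {n m : ℕ}
    (hP : P.size ≤ n) (hX : X.length ≤ m) :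
    Spec (headProjectNonDisjunctive P X) (n * (setCost n m + (2 * n + 1) + 1 + 2) + 1)
      (· = headProjectList P X) := by
  refine flatMap_spec ((length_le_size P).trans hP) (fun c hc => ?_) fun c hc => ?_
  · have := clause_length_le_size hc
    refine Spec.bind (inter_spec (by omega) hX) ?_ le_rfl
    rintro _ rfl
    refine Spec.bind (m := 0) (exactlyOne_spec (n := n)
      ((List.length_filter_le _ _).trans (by omega))) (fun e he => Spec.pure ?_) le_rfl
    simp only [he]
  · split_ifs <;> simp

/-- The simplified theory of `P` with respect to `M`, where `S` is the steady set. -/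
def simplifyList (P : ListTheory α) (M S : List α) : ListTheory α :=
  projectList (P.filter fun c => (∀ a ∈ c.1, a ∉ S) ∧ ∀ b ∈ c.2, b ∈ M) (M.filter (· ∉ S))

theorem size_simplifyList_le (P : ListTheory α) (M S : List α) :
    (simplifyList P M S).size ≤ P.size :=
  (size_projectList_le _ _).trans (size_filter_le _ _)

/-- The cost of the computation of the simplified theory. -/
def simplifyCost (n m : ℕ) : ℕ :=
  (n * (setCost n m + setCost n n + 1) + 1) + (setCost n m + projectCost n n)

theorem simplify_spec {P : ListTheory α} {M S : List α} {n m : ℕ} (hP : P.size ≤ n)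
    (hM : M.length ≤ n) (hS : S.length ≤ m) :
    Spec (simplify P M S) (simplifyCost n m) (· = simplifyList P M S) := by
  refine Spec.bind (filter_spec
    (φ := fun c : ListClause α => (∀ a ∈ c.1, a ∉ S) ∧ ∀ b ∈ c.2, b ∈ M)
    (c := setCost n m + setCost n n) ((length_le_size P).trans hP) fun c hc => ?_) ?_ le_rfl
  · have := clause_length_le_size hc
    refine Spec.bind (disjoint_spec (by omega) hS) (fun r hr => ?_) le_rfl
    refine Spec.bind (m := 0) (subset_spec (by omega) hM) (fun s hs => Spec.pure ?_) le_rfl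
    rw [← hr, ← hs]
    simp
  · rintro _ rfl
    refine Spec.bind (diff_spec hM hS) ?_ le_rfl
    rintro _ rfl
    exact project_spec ((size_filter_le _ _).trans hP) ((List.length_filter_le _ _).trans hM)

end Projections

/-! ### Unit propagation -/

section SteadySet

variable {α : Type} [DecidableEq α]

/-- The cost of unit propagation. -/
def leastModelCost (n : ℕ) : ℕ :=
  (n + 1) * ((n * (setCost n (n * n) + setCost n (n * n) + n + 2) + 1) +
    (1 + (n * n + 1)) + 1)

/-- A round adds only heads disjoint from S, so the number of atoms of P missing from S decreases.
Nonempty heads ensure that a false clause always contributes an atom; the loop therefore cannot stop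
before all clauses are true. -/
theorem leastModel_spec {P : ListTheory α} {n : ℕ} (hP : P.size ≤ n)
    (hne : ∀ c ∈ P, c.1 ≠ []) :
    Spec (leastModel P) (leastModelCost n) fun S => S.length ≤ n * n ∧
      (∀ c ∈ P, (∀ b ∈ c.2, b ∈ S) → ∃ a ∈ c.1, a ∈ S) ∧
      ∀ U : Set α, (∀ c ∈ P, (∀ b ∈ c.2, b ∈ U) → ∀ a ∈ c.1, a ∈ U) → ∀ a ∈ S, a ∈ U := by
  let μ : List α → ℕ := fun S => ((atomList P).toFinset \ S.toFinset).card
  have hμ : μ [] ≤ n := by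
    refine (Finset.card_le_card Finset.sdiff_subset).trans ?_
    exact (List.toFinset_card_le _).trans ((length_atomList_le P).trans hP)
  -- A round appends at most n entries, repetitions included, and lowers μ by at least one; the term
  -- μ S * n reserves the space for the remaining rounds.
  refine Spec.repeatLoop (fun S : List α => S.length + μ S * n ≤ n * n ∧
      ∀ U : Set α, (∀ c ∈ P, (∀ b ∈ c.2, b ∈ U) → ∀ a ∈ c.1, a ∈ U) → ∀ a ∈ S, a ∈ U)
    μ _ ?_ ?_ hμ le_rfl
  · rintro S ⟨hlen, hleast⟩
    have hS : S.length ≤ n * n := by omega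
    refine Spec.bind (Q := fun N => N = P.flatMap fun c =>
      if (∀ a ∈ c.1, a ∉ S) ∧ ∀ b ∈ c.2, b ∈ S then c.1 else []) (flatMap_spec
        ((length_le_size P).trans hP) (fun c hc => ?_) fun c hc => ?_) ?_ le_rfl
    · have := clause_length_le_size hc
      refine Spec.bind (disjoint_spec (by omega) hS) (fun r hr => ?_) le_rfl
      refine Spec.bind (m := 0) (subset_spec (by omega) hS) (fun s hs => Spec.pure ?_) le_rfl
      simp only [← hr, ← hs]
      cases r <;> cases s <;> simp
    · have := clause_length_le_size hc
      split_ifs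
      · omega
      · simp
    · intro N hN
      have hmem : ∀ a ∈ N, a ∈ atomList P ∧ a ∉ S ∧
          ∀ U : Set α, (∀ c ∈ P, (∀ b ∈ c.2, b ∈ U) → ∀ a ∈ c.1, a ∈ U) → a ∈ U := by
        intro a ha
        rw [hN, List.mem_flatMap] at ha
        obtain ⟨c, hc, ha⟩ := ha
        split_ifs at ha with h
        · exact ⟨mem_atomList.2 ⟨c, hc, Or.inl ha⟩, h.1 a ha,
            fun U hU => hU c hc (fun b hb => hleast U hU b (h.2 b hb)) a ha⟩
        · simp at ha
      have hNlen : N.length ≤ n := by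
        refine le_trans ?_ hP
        rw [hN]
        clear hne hN hmem hleast hlen hμ μ hP
        induction P with
        | nil => simp
        | cons c P ih =>
          rw [List.flatMap_cons, List.length_append, size_cons]
          have : (if (∀ a ∈ c.1, a ∉ S) ∧ ∀ b ∈ c.2, b ∈ S then c.1 else []).length
              ≤ c.1.length := by
            split_ifs <;> simp
          omega
      refine Spec.bind (isEmpty_spec N) (fun e he => ?_) le_rfl
      refine Spec.bind (m := 0) ((append_spec N S).le (m := n * n + 1) ?_) ?_ le_rfl
      · rcases Nat.eq_zero_or_pos n with rfl | hn
        · omega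
        · have : n ≤ n * n := Nat.le_mul_of_pos_left n hn
          omega
      rintro _ rfl
      refine Spec.pure ?_
      cases e
      · have hne' : N ≠ [] := fun h => by simpa using he.2 h
        obtain ⟨x, hx⟩ := List.exists_mem_of_ne_nil N hne'
        have hlt : μ (N ++ S) < μ S := by
          refine Finset.card_lt_card ((Finset.ssubset_iff_of_subset ?_).2 ⟨x, ?_, ?_⟩)
          · intro a
            simp only [Finset.mem_sdiff, List.mem_toFinset, List.mem_append]
            tauto
          · simp [(hmem x hx).1, (hmem x hx).2.1]
          · simp [hx]
        refine ⟨⟨?_, fun U hU a ha => ?_⟩, hlt⟩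
        · rw [List.length_append]
          nlinarith
        · rcases List.mem_append.1 ha with ha | ha
          · exact (hmem a ha).2.2 U hU
          · exact hleast U hU a ha
      · refine ⟨hS, fun c hc hb => ?_, hleast⟩
        by_contra! hcon
        have hN0 := he.1 rfl
        obtain ⟨x, hx⟩ := List.exists_mem_of_ne_nil _ (hne c hc)
        have : x ∈ N := by
          rw [hN, List.mem_flatMap]
          exact ⟨c, hc, by rw [if_pos ⟨hcon, hb⟩]; exact hx⟩
        rw [hN0] at this
        simp at this
  · exact ⟨by simpa using Nat.mul_le_mul_right n hμ, by simp⟩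

/-- The cost of the computation of the steady set. -/
def steadySetCost (n : ℕ) : ℕ :=
  (n * (setCost n n + (2 * n + 1) + 1 + 2) + 1) + leastModelCost n

theorem steadySet_spec {P : ListTheory α} {M : List α} {n : ℕ} (hP : P.size ≤ n)
    (hM : M.length ≤ n) : Spec (steadySet P M) (steadySetCost n) fun S =>
      S.length ≤ n * n ∧ IsSteady P M S := by
  refine Spec.bind (headProjectNonDisjunctive_spec hP hM) ?_ le_rfl
  rintro _ rfl
  refine (leastModel_spec ((size_headProjectList_le P M).trans hP) ?_).imp ?_
  · intro q hq
    obtain ⟨c, _, ⟨h, hh, hM, _⟩, rfl⟩ := mem_headProjectList.1 hq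
    exact List.ne_nil_of_mem (List.mem_filter.2 ⟨hh, by simpa using hM⟩)
  · rintro S ⟨hS, hclosed, hleast⟩
    refine ⟨hS, ⟨fun c hc h hh hhM hu hb => ?_, fun U hU => hleast U fun q hq hb a ha => ?_⟩⟩
    · obtain ⟨a, ha, haS⟩ :=
        hclosed _ (mem_headProjectList.2 ⟨c, hc, ⟨h, hh, hhM, hu⟩, rfl⟩) hb
      simp only [List.mem_filter, decide_eq_true_eq] at ha
      rwa [← hu a ha.1 ha.2]
    · obtain ⟨c, hc, ⟨h, hh, hhM, hu⟩, rfl⟩ := mem_headProjectList.1 hq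
      simp only [List.mem_filter, decide_eq_true_eq] at ha
      rw [hu a ha.1 ha.2]
      exact hU c hc h hh hhM hu hb

end SteadySet

/-! ### Reachability and strongly connected components -/

section Graph

variable {α : Type}

/-- There is a path from `u` to `v` along the arcs in `E`. -/
def Reach (E : List (α × α)) (u v : α) : Prop :=
  Relation.ReflTransGen (fun a b => (a, b) ∈ E) u v

/-- The nodes `u` and `v` are in the same strongly connected component. -/
def Same (E : List (α × α)) (u v : α) : Prop := Reach E u v ∧ Reach E v u

theorem Same.refl (E : List (α × α)) (u : α) : Same E u u :=
  ⟨Relation.ReflTransGen.refl, Relation.ReflTransGen.refl⟩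

theorem Same.symm {E : List (α × α)} {u v : α} (h : Same E u v) : Same E v u := ⟨h.2, h.1⟩

theorem Same.trans {E : List (α × α)} {u v w : α} (h : Same E u v) (h' : Same E v w) :
    Same E u w :=
  ⟨Relation.ReflTransGen.trans h.1 h'.1, Relation.ReflTransGen.trans h'.2 h.2⟩

/-- Membership in a set closed under predecessors propagates backwards along a path. In a strongly
connected graph such a set, if nonempty, contains all nodes. -/
theorem Reach.mem_of_arcs {E : List (α × α)} {Z : Set α} (hZ : ∀ e ∈ E, e.2 ∈ Z → e.1 ∈ Z)
    {u v : α} (h : Reach E u v) (hv : v ∈ Z) : u ∈ Z := by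
  induction h using Relation.ReflTransGen.head_induction_on with
  | refl => exact hv
  | head hab _ ih => exact hZ _ hab ih

open Classical in
/-- The strongly connected component of `u` in the graph with nodes `X` and arcs `E`. -/
noncomputable def component (X : List α) (E : List (α × α)) (u : α) : List α :=
  X.filter fun v => Same E u v

theorem mem_component {X : List α} {E : List (α × α)} {u v : α} :
    v ∈ component X E u ↔ v ∈ X ∧ Same E u v := by
  simp [component]

/-- A finite nonempty graph has a strongly connected component that no arc leaves. -/
theorem exists_last_component {X : List α} {E : List (α × α)} (hX : X ≠ [])
    (hE : ∀ e ∈ E, e.2 ∈ X) :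
    ∃ u ∈ X, ∀ e ∈ E, e.1 ∈ component X E u → e.2 ∈ component X E u := by
  classical
  -- Take a node that reaches the fewest nodes of X. A successor reaches no more than u does, hence
  -- by minimality exactly the same nodes, among them u; so it is in the component of u.
  obtain ⟨u, hu, hmin⟩ := X.toFinset.exists_min_image
    (fun u => (X.toFinset.filter fun v => Reach E u v).card)
    (List.toFinset_nonempty_iff X |>.2 hX)
  rw [List.mem_toFinset] at hu
  refine ⟨u, hu, fun e he h1 => mem_component.2 ⟨hE e he, ?_⟩⟩
  have h1 := (mem_component.1 h1).2.1
  have h2 : Reach E u e.2 := Relation.ReflTransGen.tail h1 he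
  have hsub : (X.toFinset.filter fun v => Reach E e.2 v) ⊆
      X.toFinset.filter fun v => Reach E u v := by
    intro v
    simp only [Finset.mem_filter]
    exact fun hv => ⟨hv.1, Relation.ReflTransGen.trans h2 hv.2⟩
  have heq := Finset.eq_of_subset_of_card_le hsub (hmin e.2 (List.mem_toFinset.2 (hE e he)))
  have : u ∈ X.toFinset.filter fun v => Reach E e.2 v := by
    rw [heq]
    simp only [Finset.mem_filter, List.mem_toFinset]
    exact ⟨hu, Relation.ReflTransGen.refl⟩
  exact ⟨h2, (Finset.mem_filter.1 this).2⟩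

variable [DecidableEq α]

/-- The cost of the search for the nodes that can be reached. -/
def reachableCost (m : ℕ) : ℕ :=
  (m + 1) * ((m * ((2 * (1 + m * m) + 1) + (2 * (1 + m * m) + 1) + 1 + 2) + 1) +
    (1 + (m + 1)) + 1)

/-- The measure counts the arc targets not yet in R. When no new target is found, R is closed under
the arcs and so contains everything reachable from u. -/
theorem reachable_spec {E : List (α × α)} (u : α) {m : ℕ} (hE : E.length ≤ m) :
    Spec (reachable E u) (reachableCost m) fun R => R.length ≤ 1 + m * m ∧
      ∀ v, v ∈ R ↔ Reach E u v := by
  let μ : List α → ℕ := fun R => ((E.map Prod.snd).toFinset \ R.toFinset).card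
  have hμ : μ [u] ≤ m := by
    refine (Finset.card_le_card Finset.sdiff_subset).trans ?_
    exact (List.toFinset_card_le _).trans (by simpa using hE)
  -- The list starts with the single entry u, and each round adds at most one entry per arc.
  refine Spec.repeatLoop (fun R : List α => R.length + μ R * m ≤ 1 + m * m ∧
      u ∈ R ∧ ∀ v ∈ R, Reach E u v) μ _ ?_ ?_ hμ le_rfl
  · rintro R ⟨hlen, huR, hreach⟩
    have hR : R.length ≤ 1 + m * m := by omega
    refine Spec.bind (Q := fun N => N = E.flatMap fun e =>
      if e.1 ∈ R ∧ e.2 ∉ R then [e.2] else []) (flatMap_spec hE (fun e _ => ?_)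
      fun e _ => ?_) ?_ le_rfl
    · refine Spec.bind (mem_spec _ hR) (fun r hr => ?_) le_rfl
      refine Spec.bind (m := 0) (notMem_spec _ hR) (fun s hs => Spec.pure ?_) le_rfl
      simp only [← hr, ← hs]
      cases r <;> cases s <;> simp
    · split_ifs <;> simp
    · intro N hN
      have hmem : ∀ a, a ∈ N ↔ ∃ e ∈ E, e.1 ∈ R ∧ e.2 ∉ R ∧ a = e.2 := by
        intro a
        rw [hN, List.mem_flatMap]
        refine exists_congr fun e => and_congr_right fun _ => ?_
        split_ifs with h
        · simp [h]
        · simp only [List.not_mem_nil, false_iff]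
          exact fun h' => h ⟨h'.1, h'.2.1⟩
      have hNlen : N.length ≤ m := by
        refine le_trans ?_ hE
        rw [hN, List.length_flatMap]
        refine (List.sum_le_card_nsmul _ 1 ?_).trans (by simp)
        intro x hx
        obtain ⟨e, _, rfl⟩ := List.mem_map.1 hx
        split_ifs <;> simp
      refine Spec.bind (isEmpty_spec N) (fun e he => ?_) le_rfl
      refine Spec.bind (m := 0) ((append_spec N R).le (m := m + 1) (by omega)) ?_ le_rfl
      rintro _ rfl
      refine Spec.pure ?_
      cases e
      · have hne' : N ≠ [] := fun h => by simpa using he.2 h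
        obtain ⟨x, hx⟩ := List.exists_mem_of_ne_nil N hne'
        have hlt : μ (N ++ R) < μ R := by
          refine Finset.card_lt_card ((Finset.ssubset_iff_of_subset ?_).2 ⟨x, ?_, ?_⟩)
          · intro a
            simp only [Finset.mem_sdiff, List.mem_toFinset, List.mem_append]
            tauto
          · obtain ⟨e, he, _, h2, rfl⟩ := (hmem x).1 hx
            simp only [Finset.mem_sdiff, List.mem_toFinset]
            exact ⟨List.mem_map_of_mem he, h2⟩
          · simp [hx]
        refine ⟨⟨?_, by simp [huR], fun v hv => ?_⟩, hlt⟩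
        · rw [List.length_append]
          nlinarith
        · rcases List.mem_append.1 hv with hv | hv
          · obtain ⟨e, he, h1, _, rfl⟩ := (hmem v).1 hv
            exact Relation.ReflTransGen.tail (hreach _ h1) he
          · exact hreach v hv
      · refine ⟨hR, fun v => ⟨hreach v, fun hv => ?_⟩⟩
        have hN0 := he.1 rfl
        induction hv with
        | refl => exact huR
        | tail _ hab ih =>
          by_contra hcon
          have := (hmem _).2 ⟨_, hab, ih, hcon, rfl⟩
          rw [hN0] at this
          simp at this
  · refine ⟨?_, by simp, ?_⟩
    · simpa using Nat.mul_le_mul_right m hμ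
    · simp only [List.mem_singleton, forall_eq]
      exact Relation.ReflTransGen.refl

/-- The cost of the comparison of the components of two nodes. -/
def sameComponentCost (m : ℕ) : ℕ :=
  reachableCost m + (reachableCost m + ((2 * (1 + m * m) + 1) + (2 * (1 + m * m) + 1)))

theorem sameComponent_spec {E : List (α × α)} (u v : α) {m : ℕ} (hE : E.length ≤ m) :
    Decides (sameComponent E u v) (sameComponentCost m) (Same E u v) := by
  refine Spec.bind (reachable_spec u hE) (fun U hU => ?_) le_rfl
  refine Spec.bind (reachable_spec v hE) (fun V hV => ?_) le_rfl
  refine Spec.bind (mem_spec v hU.1) (fun r hr => ?_) le_rfl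
  refine Spec.bind (m := 0) (mem_spec u hV.1) (fun s hs => Spec.pure ?_) le_rfl
  rw [hU.2] at hr
  rw [hV.2] at hs
  rw [Same, ← hr, ← hs]
  simp

/-- The cost of the test whether `n` nodes are in the same component. -/
def inOneComponentCost (n m : ℕ) : ℕ := n * (sameComponentCost m + 1) + 1

theorem inOneComponent_spec {E : List (α × α)} {l : List α} {n m : ℕ} (hl : l.length ≤ n)
    (hE : E.length ≤ m) : Decides (inOneComponent E l) (inOneComponentCost n m)
      (∀ u ∈ l, ∀ v ∈ l, Same E u v) := by
  cases l with
  | nil => exact Spec.ret (by unfold inOneComponentCost; omega) (by simp)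
  | cons a l =>
    refine (all_spec (n := n) (φ := fun v => Same E a v) (by simp at hl; omega) fun v _ =>
      sameComponent_spec a v hE).imp fun r hr => ?_
    rw [hr]
    constructor
    · intro h u hu v hv
      have : ∀ w ∈ a :: l, Same E a w := by
        intro w hw
        rcases List.mem_cons.1 hw with rfl | hw
        · exact Same.refl _ _
        · exact h w hw
      exact (this u hu).symm.trans (this v hv)
    · exact fun h v hv => h a (by simp) v (by simp [hv])

end Graph

/-! ### Elementary subgraphs and super-elementary sets -/

section ElementarySubgraph

variable {α : Type}

/-- The arcs from the body atoms to the head atoms of a clause. -/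
def arcs (c : ListClause α) : List (α × α) := c.2.flatMap fun b => c.1.flatMap fun h => [(b, h)]

theorem mem_arcs {c : ListClause α} {e : α × α} : e ∈ arcs c ↔ e.1 ∈ c.2 ∧ e.2 ∈ c.1 := by
  simp only [arcs, List.mem_flatMap, List.mem_singleton]
  constructor
  · rintro ⟨b, hb, h, hh, rfl⟩
    exact ⟨hb, hh⟩
  · exact fun h => ⟨e.1, h.1, e.2, h.2, rfl⟩

theorem length_arcs (c : ListClause α) : (arcs c).length = c.2.length * c.1.length := by
  simp [arcs, List.length_flatMap]

/-- The bound is linear in the size of C, so that the arcs produced in different rounds can be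
charged to the disjoint groups of clauses that produce them. -/
theorem length_flatMap_arcs_le {C : ListTheory α} {n : ℕ} (hC : C.size ≤ n) :
    (C.flatMap arcs).length ≤ n * C.size := by
  induction C with
  | nil => simp
  | cons c C ih =>
    rw [size_cons] at hC ⊢
    rw [List.flatMap_cons, List.length_append, length_arcs]
    have := ih (by omega)
    have : c.2.length * c.1.length ≤ n * (1 + c.1.length + c.2.length) :=
      Nat.mul_le_mul (by omega) (by omega)
    linarith [Nat.mul_add n (1 + c.1.length + c.2.length) (ListTheory.size C)]

theorem size_filter_add (P : ListTheory α) (p : ListClause α → Bool) :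
    ListTheory.size (P.filter p) + ListTheory.size (P.filter fun c => !p c) = P.size := by
  induction P with
  | nil => simp [ListTheory.size]
  | cons d P ih =>
    rw [size_cons, List.filter_cons, List.filter_cons]
    cases p d <;> simp [size_cons] <;> omega

/-- The graph with arcs `E` has the properties of the elementary subgraph for the projected
theory `P`. -/
structure IsElementarySubgraph (P : ListTheory α) (E : List (α × α)) : Prop where
  arcs_mem : ∀ c ∈ P, (∀ u ∈ c.2, ∀ v ∈ c.2, Same E u v) → ∀ e ∈ arcs c, e ∈ E
  closed : ∀ Z : Set α, (∀ c ∈ P, ∀ h ∈ c.1, h ∈ Z → c.2 ≠ [] → ∃ b ∈ c.2, b ∈ Z) →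
    ∀ e ∈ E, e.2 ∈ Z → e.1 ∈ Z

variable [DecidableEq α]

/-- The cost of the computation of the arcs of the elementary subgraph. -/
def elementarySubgraphCost (n : ℕ) : ℕ :=
  projectCost n n + (n + 1) * ((n * (inOneComponentCost n (n * n) + 1) + 1) +
    ((n * (inOneComponentCost n (n * n) + 1) + 1) +
      ((n * ((n * ((n * (0 + 1 + 2) + 1) + n + 2) + 1) + n * n + 2) + 1) +
        (1 + (n * n + 1)))) + 1)

/-- Only two features of the graph are needed later: a clause whose projected body lies in one
component has contributed its arcs, and a set that meets the nonempty projected body of every clause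
with a head atom in it is closed under predecessors. -/
theorem elementarySubgraph_spec {P : ListTheory α} {X : List α} {n : ℕ} (hP : P.size ≤ n)
    (hX : X.length ≤ n) : Spec (elementarySubgraph P X) (elementarySubgraphCost n) fun E =>
      E.length ≤ n * n ∧ (∀ e ∈ E, e.2 ∈ X) ∧ IsElementarySubgraph (projectList P X) E := by
  classical
  refine Spec.bind (project_spec hP hX) ?_ le_rfl
  rintro _ rfl
  have hsize : (projectList P X).size ≤ n := (size_projectList_le P X).trans hP
  -- The term n * size of the remaining clauses pays for the arcs still to be added. The last
  -- conjunct is the closure under predecessors, required for every Z since Z is only chosen once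
  -- the graph is complete.
  refine Spec.repeatLoop (fun st : ListTheory α × List (α × α) =>
    (∀ c ∈ st.1, c ∈ projectList P X) ∧ st.1.size ≤ n ∧ st.2.length + n * st.1.size ≤ n * n ∧
    (∀ c ∈ projectList P X, c ∈ st.1 ∨ ∀ e ∈ arcs c, e ∈ st.2) ∧ (∀ e ∈ st.2, e.2 ∈ X) ∧
    ∀ Z : Set α, (∀ c ∈ projectList P X, ∀ h ∈ c.1, h ∈ Z → c.2 ≠ [] → ∃ b ∈ c.2, b ∈ Z) →
      ∀ e ∈ st.2, e.2 ∈ Z → e.1 ∈ Z) (fun st => st.1.length) _ ?_ ?_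
    ((length_le_size _).trans hsize) le_rfl
  · rintro ⟨T, E⟩ ⟨hTP, hTn, hlen, harcs, hEX, hZ⟩
    dsimp only at hTP hTn hlen harcs hEX hZ ⊢
    have hE : E.length ≤ n * n := by omega
    have hTl := (length_le_size T).trans hTn
    refine Spec.bind (filter_spec
      (φ := fun c : ListClause α => ∀ u ∈ c.2, ∀ v ∈ c.2, Same E u v) hTl fun c hc =>
        inOneComponent_spec (n := n) (by have := clause_length_le_size hc; omega) hE) ?_ le_rfl
    intro (C : ListTheory α) hC
    refine Spec.bind (filter_spec
      (φ := fun c : ListClause α => ¬ ∀ u ∈ c.2, ∀ v ∈ c.2, Same E u v)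
      (c := inOneComponentCost n (n * n)) hTl fun c hc => ?_) ?_ le_rfl
    · refine Spec.bind (m := 0) (inOneComponent_spec (n := n)
        (by have := clause_length_le_size hc; omega) hE) (fun r hr => Spec.pure ?_) le_rfl
      rw [← hr]
      simp
    intro (D : ListTheory α) hD
    have hCmem : ∀ c, c ∈ C ↔ c ∈ T ∧ ∀ u ∈ c.2, ∀ v ∈ c.2, Same E u v := by
      intro c
      rw [hC, List.mem_filter, decide_eq_true_eq]
    have hDmem : ∀ c, c ∈ D ↔ c ∈ T ∧ ¬ ∀ u ∈ c.2, ∀ v ∈ c.2, Same E u v := by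
      intro c
      rw [hD, List.mem_filter, decide_eq_true_eq]
    have hD' : D = T.filter fun c => !decide (∀ u ∈ c.2, ∀ v ∈ c.2, Same E u v) := by
      rw [hD]
      refine List.filter_congr fun c _ => ?_
      rw [decide_not]
    have hCD : C.size + D.size = T.size := by
      rw [hC, hD']
      exact size_filter_add T _
    have hCDlen : C.length + D.length = T.length := by
      rw [hC, hD']
      exact (List.length_eq_length_filter_add _).symm
    have hCn : C.size ≤ n := by omega
    refine Spec.bind (Q := fun N => N = C.flatMap arcs) (flatMap_spec (n := n)
      ((length_le_size C).trans hCn) (fun c hc => ?_) fun c hc => ?_) ?_ le_rfl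
    · have := clause_length_le_size hc
      refine flatMap_spec (by omega) (fun b _ => ?_) fun b _ => ?_
      · exact flatMap_spec (L := 1) (by omega) (fun h _ => Spec.pure rfl) (by simp)
      · rw [List.length_flatMap]
        simp only [List.length_singleton, List.map_const', List.sum_replicate, smul_eq_mul]
        omega
    · have := clause_length_le_size hc
      rw [length_arcs]
      exact Nat.mul_le_mul (by omega) (by omega)
    rintro N hN
    have hNlen : N.length ≤ n * C.size := hN ▸ length_flatMap_arcs_le hCn
    have hNn : N.length ≤ n * n := hNlen.trans (Nat.mul_le_mul_left n hCn)
    refine Spec.bind (isEmpty_spec C) (fun e he => ?_) le_rfl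
    refine Spec.bind (m := 0) ((append_spec N E).le (m := n * n + 1) (by omega)) ?_ le_rfl
    rintro _ rfl
    refine Spec.pure ?_
    cases e
    · have hC0 : 0 < C.length := List.length_pos_iff.2 fun h => by simpa using he.2 h
      have hNmem : ∀ e, e ∈ N ↔ ∃ c ∈ C, e ∈ arcs c := by
        intro e
        rw [hN, List.mem_flatMap]
      refine ⟨⟨fun c hc => hTP c ((hDmem c).1 hc).1, by dsimp only; omega, ?_, fun c hc => ?_,
        fun e he => ?_, fun Z hcl e he h2 => ?_⟩, by dsimp only; omega⟩
      · dsimp only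
        rw [List.length_append]
        have : n * T.size = n * C.size + n * D.size := by rw [← hCD, Nat.mul_add]
        omega
      · rcases harcs c hc with hcT | hcE
        · by_cases hs : ∀ u ∈ c.2, ∀ v ∈ c.2, Same E u v
          · exact Or.inr fun e he => List.mem_append.2
              (Or.inl ((hNmem e).2 ⟨c, (hCmem c).2 ⟨hcT, hs⟩, he⟩))
          · exact Or.inl ((hDmem c).2 ⟨hcT, hs⟩)
        · exact Or.inr fun e he => List.mem_append.2 (Or.inr (hcE e he))
      · rcases List.mem_append.1 he with he | he
        · obtain ⟨c, hc, he⟩ := (hNmem e).1 he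
          obtain ⟨d, _, _, rfl⟩ := mem_projectList.1 (hTP c ((hCmem c).1 hc).1)
          have := (mem_arcs.1 he).2
          simp only [List.mem_filter, decide_eq_true_eq] at this
          exact this.2
        · exact hEX e he
      · rcases List.mem_append.1 he with he | he
        · obtain ⟨c, hc, he⟩ := (hNmem e).1 he
          obtain ⟨hcT, hs⟩ := (hCmem c).1 hc
          obtain ⟨h1, h2'⟩ := mem_arcs.1 he
          -- The body meets Z in b, and the tail of the new arc reaches b along old arcs, since the
          -- body lies in one component; closure for the old arcs puts that tail in Z.
          obtain ⟨b, hb, hbZ⟩ := hcl c (hTP c hcT) e.2 h2' h2 (List.ne_nil_of_mem h1)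
          exact (hs e.1 h1 b hb).1.mem_of_arcs (hZ Z hcl) hbZ
        · exact hZ Z hcl e he h2
    · have hC0 := he.1 rfl
      refine ⟨hE, hEX, fun c hc hs => ?_, hZ⟩
      rcases harcs c hc with hcT | hcE
      · have := (hCmem c).2 ⟨hcT, hs⟩
        rw [hC0] at this
        simp at this
      · exact hcE
  · refine ⟨fun c hc => hc, hsize, ?_, fun c hc => Or.inl hc, by simp, by simp⟩
    simpa using Nat.mul_le_mul_left n hsize

/-- The cost of the computation of the components in the last level. -/
def lastLevelCost (n m : ℕ) : ℕ :=
  n * (((n * (sameComponentCost m + 1) + 1) +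
    (m * ((2 * n + 1) + (2 * n + 1) + 1) + 1)) + 1 + 2) + 1

/-- Nonemptiness of the result makes the selection of a component succeed. -/
theorem lastLevel_spec {X : List α} {E : List (α × α)} {n m : ℕ} (hX : X.length ≤ n)
    (hE : E.length ≤ m) (hne : X ≠ []) (hEX : ∀ e ∈ E, e.2 ∈ X) :
    Spec (lastLevel X E) (lastLevelCost n m) fun L => L.length ≤ n ∧ L ≠ [] ∧ ∀ K ∈ L, ∃ u ∈ X,
      K = component X E u ∧ ∀ e ∈ E, e.1 ∈ K → e.2 ∈ K := by
  classical
  refine (flatMap_spec (g := fun u => if ∀ e ∈ E, e.1 ∈ component X E u → e.2 ∈ component X E u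
    then [component X E u] else []) hX (fun u _ => ?_) fun u _ => ?_).imp ?_
  · refine Spec.bind (filter_spec (φ := fun v => Same E u v) hX fun v _ =>
      sameComponent_spec u v hE) ?_ le_rfl
    intro K hK
    have hK : K = component X E u := hK
    subst hK
    have hl : (component X E u).length ≤ n := (List.length_filter_le _ _).trans hX
    refine Spec.bind (m := 0) (all_spec
      (φ := fun e : α × α => e.1 ∈ component X E u → e.2 ∈ component X E u)
      (c := (2 * n + 1) + (2 * n + 1)) hE fun e _ => ?_) (fun t ht => Spec.pure ?_) le_rfl
    · refine Spec.bind (mem_spec _ hl) (fun r hr => ?_) le_rfl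
      refine Spec.bind (m := 0) (mem_spec _ hl) (fun s hs => Spec.pure ?_) le_rfl
      rw [← hr, ← hs]
      cases r <;> cases s <;> simp
    · simp only [ht]
  · split_ifs <;> simp
  · rintro L rfl
    refine ⟨?_, ?_, ?_⟩
    · rw [List.length_flatMap]
      refine (List.sum_le_card_nsmul _ 1 ?_).trans (by simpa using hX)
      intro x hx
      obtain ⟨e, _, rfl⟩ := List.mem_map.1 hx
      split_ifs <;> simp
    · obtain ⟨u, hu, h⟩ := exists_last_component hne hEX
      refine List.ne_nil_of_mem (a := component X E u) (List.mem_flatMap.2 ⟨u, hu, ?_⟩)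
      rw [if_pos h]
      simp
    · intro K hK
      obtain ⟨u, hu, hK⟩ := List.mem_flatMap.1 hK
      split_ifs at hK with h
      · rw [List.mem_singleton] at hK
        subst hK
        exact ⟨u, hu, rfl, h⟩
      · simp at hK

/-- The cost of the computation of a super-elementary set. -/
def findSuperElementarySetCost (n : ℕ) : ℕ :=
  (n * (n + 1 + n + 2) + 1) + ((n * (2 * n + 2) + 1) +
    (n + 1) * (elementarySubgraphCost n + (inOneComponentCost n (n * n) +
      (lastLevelCost n (n * n) + (n + setCost n n))) + 1))

/-- The loop keeps X nonempty and supported: a clause of the non-disjunctive part with head in X has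
a body atom in X. Strong connectivity on exit adds that every nonempty proper part of X is outbound.
-/
theorem findSuperElementarySet_spec (ρ : List α → List (List α) → ℕ) {Q : ListTheory α} {n : ℕ}
    (hQ : Q.size ≤ n) (hne : atomList Q ≠ [])
    (hbody : ∀ c ∈ nonDisjunctiveList Q, c.2 ≠ []) :
    Spec (findSuperElementarySet ρ Q) (findSuperElementarySetCost n) fun X =>
      X.length ≤ n ∧ X ≠ [] ∧ (∀ a ∈ X, a ∈ atomList Q) ∧
      (∀ c ∈ nonDisjunctiveList Q, ∀ h ∈ c.1, h ∈ X → ∃ b ∈ c.2, b ∈ X) ∧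
      ∀ Z : Set α, (∃ a ∈ X, a ∈ Z) → (∃ a ∈ X, a ∉ Z) →
        ∃ c ∈ nonDisjunctiveList Q, ∃ h ∈ c.1, h ∈ X ∧ h ∈ Z ∧ (∃ b ∈ c.2, b ∈ X ∧ b ∉ Z) ∧
          ∀ b ∈ c.2, b ∈ X → b ∉ Z := by
  refine Spec.bind (computeAtoms_spec hQ) ?_ le_rfl
  rintro _ rfl
  refine Spec.bind (nonDisjunctivePart_spec hQ) ?_ le_rfl
  rintro _ rfl
  have hN : (nonDisjunctiveList Q).size ≤ n := (size_filter_le _ _).trans hQ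
  generalize hNQ : nonDisjunctiveList Q = N at *
  refine Spec.repeatLoop (fun X : List α => X.length ≤ n ∧ X ≠ [] ∧
    (∀ a ∈ X, a ∈ atomList Q) ∧ ∀ c ∈ N, ∀ h ∈ c.1, h ∈ X → ∃ b ∈ c.2, b ∈ X)
    List.length _ ?_ ?_ ((length_atomList_le Q).trans hQ) le_rfl
  · rintro X ⟨hX, hX0, hXQ, hsupp⟩
    refine Spec.bind (elementarySubgraph_spec hN hX) ?_ le_rfl
    rintro E ⟨hE, hEX, hgraph⟩
    refine Spec.bind (inOneComponent_spec hX hE) ?_ le_rfl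
    intro s hs
    cases s
    · refine Spec.bind (lastLevel_spec hX hE hX0 hEX) ?_ le_rfl
      rintro L ⟨hL, hL0, hLmem⟩
      refine Spec.bind (select_spec _ hL0 hL) ?_ le_rfl
      intro K hK
      obtain ⟨u, hu, rfl, hlast⟩ := hLmem K hK
      refine Spec.bind (m := 0) (diff_spec hX ((List.length_filter_le _ _).trans hX)) ?_ le_rfl
      rintro _ rfl
      refine Spec.pure ⟨⟨(List.length_filter_le _ _).trans hX, ?_, fun a ha => ?_,
        fun c hc h hh hX' => ?_⟩, ?_⟩
      -- If the component were all of X, the graph would be strongly connected and the loop would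
      -- already have been left.
      · intro h0
        simp only [List.filter_eq_nil_iff, decide_eq_true_eq, not_not] at h0
        have : false = true := hs.2 fun v hv w hw =>
          (mem_component.1 (h0 v hv)).2.symm.trans (mem_component.1 (h0 w hw)).2
        simp at this
      · exact hXQ a (List.mem_filter.1 ha).1
      · simp only [List.mem_filter, decide_eq_true_eq] at hX' ⊢
        -- If support were lost, all body atoms in X would lie in the removed component K. Then the
        -- projected body is in one component, so the graph has an arc from K to h outside K,
        -- although no arc leaves K.
        by_contra! hcon
        obtain ⟨b, hb, hbX⟩ := hsupp c hc h hh hX'.1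
        have harc := hgraph.arcs_mem _ (mem_projectList.2 ⟨c, hc, ⟨h, hh, hX'.1⟩, rfl⟩) (by
          simp only [List.mem_filter, decide_eq_true_eq]
          exact fun v hv w hw => (mem_component.1 (hcon v hv.1 hv.2)).2.symm.trans
            (mem_component.1 (hcon w hw.1 hw.2)).2) (b, h) (mem_arcs.2 (by simp [*]))
        exact hX'.2 (hlast _ harc (hcon b hb hbX))
      · refine List.length_filter_lt_length_iff_exists.2 ⟨u, hu, ?_⟩
        simpa using mem_component.2 ⟨hu, Same.refl E u⟩
    · refine Spec.pure ⟨hX, hX0, hXQ, hsupp, fun Z hZ hZ' => ?_⟩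
      -- If Z is not outbound, a clause with head in X ∩ Z and some body atom in X has a body atom
      -- in X ∩ Z. So Z is closed under predecessors, and strong connectivity carries a' into Z.
      by_contra! hcon
      obtain ⟨a, haX, haZ⟩ := hZ
      obtain ⟨a', haX', haZ'⟩ := hZ'
      refine haZ' ((hs.1 rfl a' haX' a haX).1.mem_of_arcs (hgraph.closed Z ?_) haZ)
      intro q hq h hh hhZ hq2
      obtain ⟨c, hc, _, rfl⟩ := mem_projectList.1 hq
      obtain ⟨b, hb⟩ := List.exists_mem_of_ne_nil _ hq2
      simp only [List.mem_filter, decide_eq_true_eq] at hh hb ⊢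
      by_cases hbZ : b ∈ Z
      · exact ⟨b, hb, hbZ⟩
      · obtain ⟨b', h1, h2, h3⟩ := hcon c hc h hh.1 hh.2 hhZ ⟨b, hb.1, hb.2, hbZ⟩
        exact ⟨b', ⟨h1, h2⟩, h3⟩
  · refine ⟨(length_atomList_le Q).trans hQ, hne, fun a ha => ha, fun c hc h _ _ => ?_⟩
    obtain ⟨b, hb⟩ := List.exists_mem_of_ne_nil _ (hbody c hc)
    refine ⟨b, hb, mem_atomList.2 ⟨c, ?_, Or.inr hb⟩⟩
    rw [← hNQ] at hc
    exact (List.mem_filter.1 hc).1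

end ElementarySubgraph

/-! ### Sets that can be removed from a model -/

section Elimination

variable {α : Type} [DecidableEq α] {P : ListTheory α} {M S : List α}

theorem mem_simplifyList {q : ListClause α} :
    q ∈ simplifyList P M S ↔ ∃ c ∈ P, (∀ a ∈ c.1, a ∉ S) ∧ (∀ b ∈ c.2, b ∈ M) ∧
      (∃ a ∈ c.1, a ∈ M ∧ a ∉ S) ∧
      q = (c.1.filter (· ∈ M.filter (· ∉ S)), c.2.filter (· ∈ M.filter (· ∉ S))) := by
  simp only [simplifyList, mem_projectList, List.mem_filter, decide_eq_true_eq, and_assoc]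

theorem mem_of_mem_atomList_simplifyList {a : α} (ha : a ∈ atomList (simplifyList P M S)) :
    (a ∈ M ∧ a ∉ S) ∧ a ∈ atomList P := by
  obtain ⟨q, hq, ha⟩ := mem_atomList.1 ha
  obtain ⟨c, hc, _, _, _, rfl⟩ := mem_simplifyList.1 hq
  simp only [List.mem_filter, decide_eq_true_eq] at ha
  rcases ha with ha | ha
  · exact ⟨ha.2, mem_atomList.2 ⟨c, hc, Or.inl ha.1⟩⟩
  · exact ⟨ha.2, mem_atomList.2 ⟨c, hc, Or.inr ha.1⟩⟩

/-- Clauses whose head meets S hold in every superset of S, so only the others have to be checked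
after a removal. -/
theorem sat_of_active {U : Set α} (hS : ∀ a ∈ S, a ∈ U) (h : ∀ c ∈ P, (∀ a ∈ c.1, a ∉ S) →
    (∀ b ∈ c.2, b ∈ U) → ∃ a ∈ c.1, a ∈ U) : Sat P U := by
  intro c hc hb
  by_cases hcS : ∀ a ∈ c.1, a ∉ S
  · exact h c hc hcS hb
  · push Not at hcS
    obtain ⟨a, ha, haS⟩ := hcS
    exact ⟨a, ha, hS a haS⟩

/-- Atoms outside the simplified theory and the steady set can be removed from a model. -/
theorem sat_diff_of_not_mem_atoms (hM : Sat P {a | a ∈ M}) (hS : IsSteady P M S) {D : List α}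
    (hD : ∀ a ∈ D, a ∉ S ∧ a ∉ atomList (simplifyList P M S)) :
    Sat P {a | a ∈ M ∧ a ∉ D} := by
  refine sat_of_active (fun a ha => ⟨hS.subset a ha, fun h => (hD a h).1 ha⟩)
    fun c hc hcS hb => ?_
  obtain ⟨a, ha, haM⟩ := hM c hc fun b h => (hb b h).1
  -- The clause survives simplification, so its head atom a occurs in the simplified theory and is
  -- not removed.
  refine ⟨a, ha, haM, fun haD => (hD a haD).2 (mem_atomList.2 ⟨_, mem_simplifyList.2
    ⟨c, hc, hcS, fun b h => (hb b h).1, ⟨a, ha, haM, hcS a ha⟩, rfl⟩, Or.inl ?_⟩)⟩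
  simp only [List.mem_filter, decide_eq_true_eq]
  exact ⟨ha, haM, hcS a ha⟩

/-- An atom outside the non-disjunctive part of the simplified theory and the steady set can be
removed from a model. -/
theorem sat_diff_singleton (hM : Sat P {a | a ∈ M}) (hS : IsSteady P M S) {d : α} (hdS : d ∉ S)
    (hd : d ∉ atomList (nonDisjunctiveList (simplifyList P M S))) :
    Sat P {a | a ∈ M ∧ a ∉ [d]} := by
  refine sat_of_active (fun a ha => ⟨hS.subset a ha, fun h => ?_⟩) fun c hc hcS hb => ?_
  · rw [List.mem_singleton] at h
    exact hdS (h ▸ ha)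
  obtain ⟨a, ha, haM⟩ := hM c hc fun b h => (hb b h).1
  have haR : a ∈ c.1.filter (· ∈ M.filter (· ∉ S)) := by
    simp only [List.mem_filter, decide_eq_true_eq]
    exact ⟨ha, haM, hcS a ha⟩
  by_contra! hcon
  -- A clause falsified by removing d has d as its only head atom in M; its projection is then
  -- non-disjunctive and contains d.
  have hall : ∀ x ∈ c.1, x ∈ M → x = d := fun x hx hxM => by
    by_contra hxd
    exact hcon x hx ⟨hxM, by simpa using hxd⟩
  refine hd (mem_atomList.2 ⟨_, List.mem_filter.2 ⟨mem_simplifyList.2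
    ⟨c, hc, hcS, fun b h => (hb b h).1, ⟨a, ha, haM, hcS a ha⟩, rfl⟩, ?_⟩,
    Or.inl (hall a ha haM ▸ haR)⟩)
  simp only [List.mem_filter, decide_eq_true_eq]
  exact fun x hx y hy => (hall x hx.1 hx.2.1).trans (hall y hy.1 hy.2.1).symm

/-- If the simplified theory is non-disjunctive then the steady set is a model. -/
theorem sat_steady (hM : Sat P {a | a ∈ M}) (hS : IsSteady P M S)
    (hQ : ∀ c ∈ simplifyList P M S, ∀ a ∈ c.1, ∀ b ∈ c.1, a = b) : Sat P {a | a ∈ S} := by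
  refine sat_of_active (fun a ha => ha) fun c hc hcS hb => ?_
  have hbM : ∀ b ∈ c.2, b ∈ M := fun b h => hS.subset b (hb b h)
  obtain ⟨a, ha, haM⟩ := hM c hc hbM
  have := hQ _ (mem_simplifyList.2 ⟨c, hc, hcS, hbM, ⟨a, ha, haM, hcS a ha⟩, rfl⟩)
  simp only [List.mem_filter, decide_eq_true_eq] at this
  exact ⟨a, ha, hS.closed c hc a ha haM
    (fun x hx hxM => this x ⟨hx, hxM, hcS x hx⟩ a ⟨ha, haM, hcS a ha⟩) hb⟩

/-- The non-disjunctive clauses of the simplified theory have nonempty bodies. -/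
theorem body_ne_nil_of_mem_simplifyList (hS : IsSteady P M S) :
    ∀ q ∈ nonDisjunctiveList (simplifyList P M S), q.2 ≠ [] := by
  intro q hq hq0
  obtain ⟨hq, hnd⟩ := List.mem_filter.1 hq
  obtain ⟨c, hc, hcS, hcM, ⟨h, hh, hhM, hhS⟩, rfl⟩ := mem_simplifyList.1 hq
  simp only [List.mem_filter, decide_eq_true_eq, List.filter_eq_nil_iff, not_and, not_not]
    at hnd hq0
  -- The body lies in M, and if its projection on M \ S is empty, it lies in S; unit propagation
  -- would then have put the head atom into S.
  exact hhS (hS.closed c hc h hh hhM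
    (fun x hx hxM => hnd x ⟨hx, hxM, hcS x hx⟩ h ⟨hh, hhM, hhS⟩) fun b hb => hq0 b hb (hcM b hb))

/-- The outbound condition makes X an elementary set, which by the HEF property meets each head in
at most one atom. -/
theorem IsHEF.eq_of_mem (hP : IsHEF P.toTheory) {X : List α} (hX : X ≠ [])
    (hXP : ∀ a ∈ X, a ∈ atomList P)
    (hout : ∀ Z : Set α, (∃ a ∈ X, a ∈ Z) → (∃ a ∈ X, a ∉ Z) →
      ∃ c ∈ P, (∃ h ∈ c.1, h ∈ X ∧ h ∈ Z) ∧ (∃ b ∈ c.2, b ∈ X ∧ b ∉ Z) ∧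
        (∀ b ∈ c.2, b ∈ X → b ∉ Z) ∧ ∀ h ∈ c.1, h ∈ X → h ∈ Z) :
    ∀ c ∈ P, ∀ x ∈ c.1, ∀ y ∈ c.1, x ∈ X → y ∈ X → x = y := by
  intro c hc x hx y hy hxX hyX
  have hmem : ∀ c ∈ P, (c.1.toFinset, c.2.toFinset) ∈ P.toTheory := fun c hc => by
    simp only [ListTheory.toTheory, List.mem_toFinset, List.mem_map]
    exact ⟨c, hc, rfl⟩
  by_contra hxy
  refine hP _ (hmem c hc) ⟨X.toFinset, ⟨List.toFinset_nonempty_iff X |>.2 hX, ?_, ?_⟩, ?_⟩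
  · intro a ha
    obtain ⟨d, hd, had⟩ := mem_atomList.1 (hXP a (List.mem_toFinset.1 ha))
    exact Finset.mem_biUnion.2 ⟨_, hmem d hd, by simpa using had⟩
  · intro Z hZ hZ0
    have hZX : ∀ a ∈ Z, a ∈ X := fun a ha => List.mem_toFinset.1 (hZ.1 ha)
    obtain ⟨a, ha⟩ := hZ0
    obtain ⟨a', ha', haZ'⟩ := Finset.exists_of_ssubset hZ
    obtain ⟨d, hd, ⟨h, hh, hhX, hhZ⟩, ⟨b, hb, hbX, hbZ⟩, h3, h4⟩ := hout (Z : Set α)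
      ⟨a, hZX a ha, ha⟩ ⟨a', List.mem_toFinset.1 ha', haZ'⟩
    refine ⟨hZ.1, _, hmem d hd, ⟨h, ?_⟩, ⟨b, ?_⟩, ?_, ?_⟩
    · simpa using ⟨hh, hhZ⟩
    · simpa using ⟨hb, hbX, hbZ⟩
    · refine Finset.eq_empty_of_forall_notMem fun b hb => ?_
      simp only [Finset.mem_inter, List.mem_toFinset] at hb
      exact h3 b hb.1 (hZX b hb.2) hb.2
    · refine Finset.eq_empty_of_forall_notMem fun b hb => ?_
      simp only [Finset.mem_inter, Finset.mem_sdiff, List.mem_toFinset] at hb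
      exact hb.2.2 (h4 b hb.1 hb.2.1)
  · rw [Finset.one_lt_card]
    exact ⟨x, by simp [hx, hxX], y, by simp [hy, hyX], hxy⟩

/-- A super-elementary set can be removed from a model of a head-elementary-set-free theory. -/
theorem sat_diff_superElementary (hP : IsHEF P.toTheory) (hM : Sat P {a | a ∈ M})
    (hS : IsSteady P M S) {X : List α} (hX : X ≠ [])
    (hXQ : ∀ a ∈ X, a ∈ atomList (simplifyList P M S))
    (hsupp : ∀ c ∈ nonDisjunctiveList (simplifyList P M S), ∀ h ∈ c.1, h ∈ X → ∃ b ∈ c.2, b ∈ X)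
    (hout : ∀ Z : Set α, (∃ a ∈ X, a ∈ Z) → (∃ a ∈ X, a ∉ Z) →
      ∃ c ∈ nonDisjunctiveList (simplifyList P M S), ∃ h ∈ c.1, h ∈ X ∧ h ∈ Z ∧
        (∃ b ∈ c.2, b ∈ X ∧ b ∉ Z) ∧ ∀ b ∈ c.2, b ∈ X → b ∉ Z) :
    Sat P {a | a ∈ M ∧ a ∉ X} := by
  have hXR := fun a ha => (mem_of_mem_atomList_simplifyList (hXQ a ha)).1
  -- Outboundness lifts from the simplified theory to P: X lies in M \ S, so projecting a clause on
  -- M \ S does not change which of its atoms are in X.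
  have hhead := hP.eq_of_mem hX (fun a ha => (mem_of_mem_atomList_simplifyList (hXQ a ha)).2) (by
    intro Z hZ hZ'
    obtain ⟨q, hq, h, hh, hhX, hhZ, ⟨b, hb, hbX, hbZ⟩, hbody⟩ := hout Z hZ hZ'
    obtain ⟨hq, hnd⟩ := List.mem_filter.1 hq
    obtain ⟨c, hc, hcS, _, _, rfl⟩ := mem_simplifyList.1 hq
    simp only [List.mem_filter, decide_eq_true_eq] at hnd hh hb hbody
    refine ⟨c, hc, ⟨h, hh.1, hhX, hhZ⟩, ⟨b, hb.1, hbX, hbZ⟩,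
      fun b hb hbX => hbody b ⟨hb, hXR b hbX⟩ hbX, fun x hx hxX => ?_⟩
    rwa [hnd x ⟨hx, hXR x hxX⟩ h hh])
  refine sat_of_active (fun a ha => ⟨hS.subset a ha, fun h => (hXR a h).2 ha⟩)
    fun c hc hcS hb => ?_
  have hbM : ∀ b ∈ c.2, b ∈ M := fun b h => (hb b h).1
  obtain ⟨a, ha, haM⟩ := hM c hc hbM
  by_contra! hcon
  have hall : ∀ x ∈ c.1, x ∈ M → x ∈ X := fun x hx hxM => by
    by_contra hxX
    exact hcon x hx ⟨hxM, hxX⟩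
  -- All head atoms of c in M lie in X, so by `hhead` there is just one, and the projected clause is
  -- non-disjunctive. Support gives a body atom in X, but the body avoids X.
  obtain ⟨b, hbc, hbX⟩ := hsupp _ (List.mem_filter.2 ⟨mem_simplifyList.2
    ⟨c, hc, hcS, hbM, ⟨a, ha, haM, hcS a ha⟩, rfl⟩, by
      simp only [List.mem_filter, decide_eq_true_eq]
      exact fun x hx y hy => hhead c hc x hx.1 y hy.1 (hall x hx.1 hx.2.1) (hall y hy.1 hy.2.1)⟩)
    a (by simp only [List.mem_filter, decide_eq_true_eq]; exact ⟨ha, haM, hcS a ha⟩)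
    (hall a ha haM)
  exact (hb b (List.mem_filter.1 hbc).1).2 hbX

end Elimination

/-! ### The eliminating operator and the elimination algorithm -/

section Algorithm

variable {α : Type} [DecidableEq α]

/-- The cost of a round of the first loop of the operator. -/
def xiHEFRoundCost (n : ℕ) : ℕ :=
  setCost n (n * n) + (steadySetCost n + (setCost n (n * n) + (simplifyCost n (n * n) +
    ((n * (n + 1 + n + 2) + 1) + ((n * (2 * n + 2) + 1) + ((n * (n + 1 + n + 2) + 1) +
      ((setCost n n + setCost n n) + ((setCost n n + setCost n n) + ((setCost n n + n) +
        ((n * n + 1) + 1))))))))))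

/-- The two outcomes separate the data needed after the loop from the progress needed inside it: a
round that continues removes a nonempty part D of the current model and leaves a model. -/
theorem xiHEFRound_spec (ρ : ChoiceRules α) {P : ListTheory α} {M₀ E : List α} {n : ℕ}
    (hP : P.size ≤ n) (hM₀ : M₀.length ≤ n) (hE : E.length ≤ n * n)
    (hM : Sat P {a | a ∈ M₀.filter (· ∉ E)}) :
    Spec (xiHEFRound ρ P (M₀, E)) (xiHEFRoundCost n) (Sum.elim
      (fun r => r.1 = M₀.filter (· ∉ E) ∧ r.2.1.length ≤ n * n ∧ IsSteady P r.1 r.2.1 ∧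
        r.2.2.1 = simplifyList P r.1 r.2.1 ∧ r.2.2.2 = E)
      fun st => st.1 = M₀.filter (· ∉ E) ∧ ∃ D, st.2 = E ++ D ∧ D ≠ [] ∧ D.length ≤ n ∧
        (∀ a ∈ D, a ∈ M₀.filter (· ∉ E)) ∧
        Sat P {a | a ∈ M₀.filter (· ∉ E) ∧ a ∉ D}) := by
  refine Spec.bind (diff_spec hM₀ hE) ?_ le_rfl
  rintro _ rfl
  dsimp only
  have hMn : (M₀.filter (· ∉ E)).length ≤ n := (List.length_filter_le _ _).trans hM₀
  generalize M₀.filter (· ∉ E) = M at *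
  refine Spec.bind (steadySet_spec hP hMn) ?_ le_rfl
  rintro S ⟨hSn, hS⟩
  refine Spec.bind (diff_spec hMn hSn) ?_ le_rfl
  rintro _ rfl
  have hRn : (M.filter (· ∉ S)).length ≤ n := (List.length_filter_le _ _).trans hMn
  refine Spec.bind (simplify_spec hP hMn hSn) ?_ le_rfl
  rintro _ rfl
  have hQn := (size_simplifyList_le P M S).trans hP
  refine Spec.bind (computeAtoms_spec hQn) ?_ le_rfl
  rintro _ rfl
  refine Spec.bind (nonDisjunctivePart_spec hQn) ?_ le_rfl
  rintro _ rfl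
  have hNn : (nonDisjunctiveList (simplifyList P M S)).size ≤ n :=
    (size_filter_le _ _).trans hQn
  refine Spec.bind (computeAtoms_spec hNn) ?_ le_rfl
  rintro _ rfl
  have hAn := (length_atomList_le _).trans hQn
  have hBn := (length_atomList_le _).trans hNn
  refine Spec.bind (ssupset_spec hRn hAn) (fun s _ => ?_) le_rfl
  refine Spec.bind (ssupset_spec hRn hBn) (fun t ht => ?_) le_rfl
  refine Spec.bind (Q := fun D : List α => D.length ≤ n ∧ (∀ a ∈ D, a ∈ M) ∧
    Sat P {a | a ∈ M ∧ a ∉ D}) ?_ ?_ le_rfl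
  · cases s
    · cases t
      · exact Spec.pure ⟨Nat.zero_le _, by simp, by simpa using hM⟩
      · refine Spec.bind (m := n) (diff_spec hRn hBn) ?_ le_rfl
        rintro _ rfl
        refine Spec.bind (m := 0) (select_spec _ ?_
          ((List.length_filter_le _ _).trans hRn)) ?_ le_rfl
        -- The failed inclusion supplies a candidate, so the selection does not diverge.
        · have := (ht.1 rfl).2
          push Not at this
          obtain ⟨a, ha, haB⟩ := this
          exact List.ne_nil_of_mem (List.mem_filter.2 ⟨ha, by simpa using haB⟩)
        · intro a ha
          simp only [List.mem_filter, decide_eq_true_eq] at ha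
          refine Spec.pure ⟨?_, by simpa using ha.1.1, sat_diff_singleton hM hS ha.1.2 ha.2⟩
          exact (List.length_pos_of_mem ha.1.1).trans_le hMn
    · refine (diff_spec hRn hAn).mono (Nat.le_add_right _ _) ?_
      rintro _ rfl
      refine ⟨(List.length_filter_le _ _).trans hRn, fun a ha => ?_,
        sat_diff_of_not_mem_atoms hM hS fun a ha => ?_⟩
      · exact (List.mem_filter.1 (List.mem_filter.1 ha).1).1
      · simp only [List.mem_filter, decide_eq_true_eq] at ha
        exact ⟨ha.1.2, ha.2⟩
  · rintro D ⟨hDn, hDM, hD⟩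
    refine Spec.bind ((append_spec E D).le (m := n * n + 1) (by omega)) ?_ le_rfl
    rintro _ rfl
    refine Spec.bind (m := 0) (isEmpty_spec D) (fun e he => Spec.pure ?_) le_rfl
    cases e
    · exact ⟨rfl, D, rfl, fun h => by simpa using he.2 h, hDn, hDM, hD⟩
    · have hD0 := he.1 rfl
      exact ⟨rfl, hSn, hS, rfl, by simp [hD0]⟩

/-- The cost of the eliminating operator. -/
def xiHEFCost (n : ℕ) : ℕ :=
  (n + 1) * (xiHEFRoundCost n + 1) + ((n * (2 * n + 2) + 1) +
    ((setCost n (n * n) + findSuperElementarySetCost n) + (n * n + 1)))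

/-- An empty result means that nothing was eliminated and that the final model, equal to W as a set,
lies in its steady set; this is what gives minimality in the caller. -/
theorem xiHEF_spec (ρ : ChoiceRules α) {P : ListTheory α} {W : List α} {n : ℕ}
    (hHEF : IsHEF P.toTheory) (hP : P.size ≤ n) (hW : W.length ≤ n) (hsat : Sat P {a | a ∈ W}) :
    Spec (xiHEF ρ P W) (xiHEFCost n) fun E => E.length ≤ n * n + n ∧ (∀ a ∈ E, a ∈ W) ∧
      Sat P {a | a ∈ W ∧ a ∉ E} ∧
      (E = [] → ∃ M S, (∀ a, a ∈ M ↔ a ∈ W) ∧ IsSteady P M S ∧ ∀ a ∈ M, a ∈ S) := by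
  refine Spec.bind (Q := fun r : List α × List α × ListTheory α × List α =>
      r.1.length ≤ n ∧ (∀ a, a ∈ r.1 ↔ a ∈ W ∧ a ∉ r.2.2.2) ∧ (∀ a ∈ r.2.2.2, a ∈ W) ∧
      Sat P {a | a ∈ r.1} ∧ r.2.2.2.length ≤ n * n ∧ r.2.1.length ≤ n * n ∧
      IsSteady P r.1 r.2.1 ∧ r.2.2.1 = simplifyList P r.1 r.2.1)
    -- The state holds the model before the latest elimination, which only takes effect at the start
    -- of the next round; hence the invariant speaks of the filtered list. Each elimination adds at
    -- most n entries and shortens that list, which bounds E' by n * n.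
    (Spec.repeatLoop (fun st : List α × List α => st.1.length ≤ n ∧
        (∀ a, a ∈ st.1.filter (· ∉ st.2) ↔ a ∈ W ∧ a ∉ st.2) ∧ (∀ a ∈ st.2, a ∈ W) ∧
        Sat P {a | a ∈ st.1.filter (· ∉ st.2)} ∧
        st.2.length + (st.1.filter (· ∉ st.2)).length * n ≤ n * n)
      (fun st => (st.1.filter (· ∉ st.2)).length) (xiHEFRoundCost n) ?_ ?_ (k := n) ?_ le_rfl)
    ?_ le_rfl
  · rintro ⟨M₀, E⟩ ⟨hM₀, hmem, hEW, hM, hlen⟩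
    dsimp only at hM₀ hmem hEW hM hlen ⊢
    have hEn : E.length ≤ n * n := by omega
    refine (xiHEFRound_spec ρ hP hM₀ hEn hM).imp ?_
    have hMn : (M₀.filter (· ∉ E)).length ≤ n := (List.length_filter_le _ _).trans hM₀
    generalize M₀.filter (· ∉ E) = M at *
    rintro (⟨M', S, Q, E'⟩ | ⟨M', E'⟩)
    · rintro ⟨h1, h2, h3, h4, h5⟩
      dsimp only at h1 h2 h3 h4 h5
      subst h1 h4 h5
      exact ⟨hMn, hmem, hEW, hM, hEn, h2, h3, rfl⟩
    · rintro ⟨h1, D, h2, hD0, hDn, hDM, hD⟩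
      dsimp only at h1 h2
      subst h1 h2
      have hmem' : ∀ a, a ∈ M'.filter (· ∉ E ++ D) ↔ a ∈ M' ∧ a ∉ D := by
        intro a
        have := hmem a
        simp only [List.mem_filter, List.mem_append, decide_eq_true_eq]
        tauto
      have hlt : (M'.filter (· ∉ E ++ D)).length < M'.length := by
        obtain ⟨d, hd⟩ := List.exists_mem_of_ne_nil D hD0
        exact List.length_filter_lt_length_iff_exists.2 ⟨d, hDM d hd, by simp [hd]⟩
      refine ⟨⟨hMn, fun a => ?_, fun a ha => ?_, ?_, ?_⟩, hlt⟩
      · rw [hmem', hmem, List.mem_append]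
        tauto
      · rcases List.mem_append.1 ha with ha | ha
        · exact hEW a ha
        · exact ((hmem a).1 (hDM a ha)).1
      · simpa only [hmem'] using hD
      · dsimp only
        rw [List.length_append]
        nlinarith
  · exact ⟨hW, by simp, by simp, by simpa using hsat, by simpa using Nat.mul_le_mul_right n hW⟩
  · simpa using hW
  · rintro ⟨M, S, Q, E⟩ ⟨hMn, hmem, hEW, hM, hEn, hSn, hS, hQ⟩
    dsimp only at hMn hmem hEW hM hEn hSn hS hQ ⊢
    subst hQ
    have hQn := (size_simplifyList_le P M S).trans hP
    refine Spec.bind (isNonDisjunctive_spec hQn) (fun e he => ?_) le_rfl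
    refine Spec.bind (Q := fun X : List α => X.length ≤ n ∧ (∀ a ∈ X, a ∈ M) ∧
      Sat P {a | a ∈ M ∧ a ∉ X} ∧ (X = [] → ∀ a ∈ M, a ∈ S)) ?_ ?_ le_rfl
    · cases e
      · have hdis := he.not.1 (by simp)
        push Not at hdis
        -- A disjunctive clause supplies an atom, so the search for a super-elementary set starts
        -- from a nonempty set.
        obtain ⟨c, hc, a, ha, _⟩ := hdis
        refine (findSuperElementarySet_spec (ρ.component M) hQn (List.ne_nil_of_mem
          (mem_atomList.2 ⟨c, hc, Or.inl ha⟩)) (body_ne_nil_of_mem_simplifyList hS)).mono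
          (Nat.le_add_left _ _) ?_
        rintro X ⟨hXn, hX0, hXQ, hsupp, hout⟩
        exact ⟨hXn, fun a ha => (mem_of_mem_atomList_simplifyList (hXQ a ha)).1.1,
          sat_diff_superElementary hHEF hM hS hX0 hXQ hsupp hout, fun h => absurd h hX0⟩
      · refine (diff_spec hMn hSn).mono (Nat.le_add_right _ _) ?_
        rintro _ rfl
        refine ⟨(List.length_filter_le _ _).trans hMn, fun a ha => (List.mem_filter.1 ha).1, ?_, ?_⟩
        -- Removing M \ S from M leaves exactly S, which is a model as the simplified theory is
        -- non-disjunctive.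
        · convert sat_steady hM hS (he.1 rfl) using 3 with a
          have := hS.subset a
          simp only [List.mem_filter, decide_eq_true_eq]
          tauto
        · simp [List.filter_eq_nil_iff]
    · rintro X ⟨hXn, hXM, hX, hX0⟩
      refine (append_spec E X).mono (by omega) ?_
      rintro _ rfl
      refine ⟨by rw [List.length_append]; omega, fun a ha => ?_, ?_, fun h0 => ?_⟩
      · rcases List.mem_append.1 ha with ha | ha
        · exact hEW a ha
        · exact ((hmem a).1 (hXM a ha)).1
      · convert hX using 3 with a
        rw [hmem, List.mem_append]
        tauto
      · obtain ⟨rfl, rfl⟩ := List.append_eq_nil_iff.1 h0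
        exact ⟨M, S, by simpa using hmem, hS, hX0 rfl⟩

/-- The cost of the Generalized Elimination Algorithm with the operator `ξ_HEF`. -/
def geaCost (n : ℕ) : ℕ :=
  (n * 2 + 1) + (n + 1) * (steadySetCost n + (satisfiesCost n (n * n) +
    (xiHEFCost n + (1 + setCost n (n * n + n)))) + 1)

/-- A set outbound by a clause of the smaller theory is outbound by the same clause of the larger
one, so elementary sets persist. This is applied to the removal of constraints. -/
theorem IsHEF.mono {P Q : Theory α} (hQ : IsHEF Q) (h : P ⊆ Q) : IsHEF P := by
  rintro c hc ⟨E, ⟨hE0, hEP, hE⟩, hcard⟩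
  refine hQ c (h hc) ⟨E, ⟨hE0, hEP.trans (Finset.biUnion_subset_biUnion_of_subset_left _ h),
    fun Z hZ hZ0 => ?_⟩, hcard⟩
  obtain ⟨hZE, d, hd, hout⟩ := hE Z hZ hZ0
  exact ⟨hZE, d, h hd, hout⟩

/-- Every round that continues shortens M and keeps it a model of the constraint-free part. Both
exits return a set that is included in each of its submodels. -/
theorem gea_spec (ρ : ChoiceRules α) {P : ListTheory α} {W : List α} {n : ℕ}
    (hHEF : IsHEF P.toTheory) (hP : P.size ≤ n) (hW : W.length ≤ n)
    (hsat : IsModel P.toTheory W.toFinset) :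
    Spec (gea (xiHEF ρ) P W) (geaCost n) fun R => R.length ≤ n * n + n ∧
      IsMinimalModel P.toTheory R.toFinset ∧ R.toFinset ⊆ W.toFinset := by
  refine Spec.bind (removeConstraints_spec hP) ?_ le_rfl
  rintro _ rfl
  rw [isModel_iff] at hsat
  simp only [List.mem_toFinset, List.coe_toFinset] at hsat
  obtain ⟨hWP, hsat⟩ := hsat
  set P' : ListTheory α := P.filter fun c => c.1 ≠ [] with hP'
  have hP'n : P'.size ≤ n := (size_filter_le _ _).trans hP
  have hsub : ∀ c ∈ P', c ∈ P := fun c hc => (List.mem_filter.1 hc).1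
  have hHEF' : IsHEF P'.toTheory := hHEF.mono (by
    intro c hc
    simp only [ListTheory.toTheory, List.mem_toFinset, List.mem_map] at hc ⊢
    obtain ⟨d, hd, rfl⟩ := hc
    exact ⟨d, hsub d hd, rfl⟩)
  refine (Spec.repeatLoop (Post := fun R : List α => R.length ≤ n * n + n ∧
      (∀ a ∈ R, a ∈ W) ∧ Sat P' {a | a ∈ R} ∧
      ∀ U : Set α, Sat P' U → (∀ a ∈ U, a ∈ R) → ∀ a ∈ R, a ∈ U)
    (fun M : List α => M.length ≤ n ∧ (∀ a ∈ M, a ∈ W) ∧ Sat P' {a | a ∈ M})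
    List.length _ ?_ ?_ hW le_rfl).imp ?_
  · rintro M ⟨hMn, hMW, hM⟩
    refine Spec.bind (steadySet_spec hP'n hMn) ?_ le_rfl
    rintro S ⟨hSn, hS⟩
    refine Spec.bind (satisfies_spec hP'n hSn) (fun s hs => ?_) le_rfl
    cases s
    · refine Spec.bind (xiHEF_spec ρ hHEF' hP'n hMn hM) ?_ le_rfl
      rintro E ⟨hEn, hEM, hE, hE0⟩
      refine Spec.bind (isEmpty_spec E) (fun e he => ?_) le_rfl
      cases e
      · refine Spec.bind (m := 0) (diff_spec hMn hEn) ?_ le_rfl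
        rintro _ rfl
        obtain ⟨a, ha⟩ := List.exists_mem_of_ne_nil E fun h => by simpa using he.2 h
        refine Spec.pure ⟨⟨(List.length_filter_le _ _).trans hMn,
          fun a ha => hMW a (List.mem_filter.1 ha).1, ?_⟩, ?_⟩
        · simpa only [List.mem_filter, decide_eq_true_eq] using hE
        · exact List.length_filter_lt_length_iff_exists.2 ⟨a, hEM a ha, by simpa using ha⟩
      -- The current model lies in a steady set of itself, and each of its submodels contains this
      -- steady set.
      · obtain ⟨M', S', hM', hS', hMS⟩ := hE0 (he.1 rfl)
        exact Spec.pure ⟨by omega, hMW, hM, fun U hU hUM a ha =>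
          hS'.subset_model hU (fun b hb => (hM' b).2 (hUM b hb)) a (hMS a ((hM' a).2 ha))⟩
    · exact Spec.pure ⟨by omega, fun a ha => hMW a (hS.subset a ha), hs.1 rfl,
        fun U hU hUS => hS.subset_model hU fun b hb => hS.subset b (hUS b hb)⟩
  · exact ⟨hW, fun a ha => ha, fun c hc => hsat c (hsub c hc)⟩
  · rintro R ⟨hRn, hRW, hR, hmin⟩
    refine ⟨hRn, ⟨isModel_iff.2 ⟨fun a ha => hWP a (hRW a (List.mem_toFinset.1 ha)), ?_⟩,
      fun N hN hNmod => hN.2 ?_⟩, fun a ha => by simpa using hRW a (List.mem_toFinset.1 ha)⟩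
    · rw [List.coe_toFinset]
      intro c hc hb
      refine hR c (List.mem_filter.2 ⟨hc, ?_⟩) hb
      -- Constraints come back for free: a clause with body in R has its body in the original model
      -- W, where it is true, so its head is not empty.
      obtain ⟨a, ha, _⟩ := hsat c hc fun b h => hRW b (hb b h)
      simpa using List.ne_nil_of_mem ha
    · have hNsat := (isModel_iff.1 hNmod).2
      intro a ha
      exact hmin N (fun c hc => hNsat c (hsub c hc))
        (fun b hb => List.mem_toFinset.1 (hN.1 hb)) a (List.mem_toFinset.1 ha)

/-- The returned R is a minimal model inside W, so W is minimal exactly when R is all of W. -/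
theorem checkMinimalModel_spec (ρ : ChoiceRules α) {P : ListTheory α} {W : List α} {n : ℕ}
    (hHEF : IsHEF P.toTheory) (hP : P.size ≤ n) (hW : W.length ≤ n)
    (hsat : IsModel P.toTheory W.toFinset) :
    Decides (checkMinimalModel ρ P W)
      (geaCost n + (setCost (n * n + n) n + setCost n (n * n + n)))
      (IsMinimalModel P.toTheory W.toFinset) := by
  refine Spec.bind (gea_spec ρ hHEF hP hW hsat) ?_ le_rfl
  rintro R ⟨hRn, hR, hRW⟩
  refine Spec.bind (subset_spec hRn hW) (fun r hr => ?_) le_rfl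
  refine Spec.bind (m := 0) (subset_spec hW hRn) (fun s hs => Spec.pure ?_) le_rfl
  have hrt : r = true := hr.2 fun a ha => by simpa using hRW (List.mem_toFinset.2 ha)
  rw [hrt, Bool.true_and, hs]
  constructor
  · intro h
    rwa [Finset.Subset.antisymm (fun a ha => List.mem_toFinset.2 (h a (List.mem_toFinset.1 ha)))
      hRW]
  · intro h a ha
    by_contra haR
    refine h.2 _ (Finset.ssubset_iff_subset_ne.2 ⟨hRW, fun heq => haR ?_⟩) hR.1
    rwa [← List.mem_toFinset, heq, List.mem_toFinset]

/-- In a positive theory every clause has a head atom, so the set of all atoms is a model to start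
from. -/
theorem findMinimalModel_spec (ρ : ChoiceRules α) {P : ListTheory α} {n : ℕ}
    (hHEF : IsHEF P.toTheory) (hP : P.size ≤ n) (hpos : IsPositive P.toTheory) :
    Spec (findMinimalModel ρ P) ((n * (n + 1 + n + 2) + 1) + geaCost n)
      fun R => IsMinimalModel P.toTheory R.toFinset := by
  refine Spec.bind (computeAtoms_spec hP) ?_ le_rfl
  rintro _ rfl
  refine (gea_spec ρ hHEF hP ((length_atomList_le P).trans hP) ?_).imp fun R hR => hR.2.1
  rw [isModel_iff]
  simp only [List.mem_toFinset, imp_self, implies_true, List.coe_toFinset, true_and]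
  intro c hc _
  obtain ⟨a, ha⟩ := hpos (c.1.toFinset, c.2.toFinset) (by
    simp only [ListTheory.toTheory, List.mem_toFinset, List.mem_map]
    exact ⟨c, hc, rfl⟩)
  have ha := List.mem_toFinset.1 ha
  exact ⟨a, ha, mem_atomList.2 ⟨c, hc, Or.inl ha⟩⟩

end Algorithm

/-! ### Polynomial bounds and the theorem -/

section PolynomialBounds

/-- The function is given by a polynomial. -/
def IsPoly (f : ℕ → ℕ) : Prop := ∃ p : Polynomial ℕ, ∀ n, f n = p.eval n

theorem IsPoly.id : IsPoly fun n => n := ⟨Polynomial.X, by simp⟩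

theorem IsPoly.const (c : ℕ) : IsPoly fun _ => c := ⟨Polynomial.C c, by simp⟩

theorem IsPoly.add {f g : ℕ → ℕ} (hf : IsPoly f) (hg : IsPoly g) : IsPoly fun n => f n + g n := by
  obtain ⟨p, hp⟩ := hf
  obtain ⟨q, hq⟩ := hg
  exact ⟨p + q, by simp [hp, hq]⟩

theorem IsPoly.mul {f g : ℕ → ℕ} (hf : IsPoly f) (hg : IsPoly g) : IsPoly fun n => f n * g n := by
  obtain ⟨p, hp⟩ := hf
  obtain ⟨q, hq⟩ := hg
  exact ⟨p * q, by simp [hp, hq]⟩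

/-- This sum dominates the costs of minimization, checking and finding, so one polynomial serves all
three. -/
theorem isPoly_cost : IsPoly fun n => (n * (n + 1 + n + 2) + 1) + (geaCost n +
    (setCost (n * n + n) n + setCost n (n * n + n))) := by
  unfold geaCost xiHEFCost findSuperElementarySetCost lastLevelCost elementarySubgraphCost
    inOneComponentCost sameComponentCost reachableCost xiHEFRoundCost steadySetCost
    leastModelCost simplifyCost projectCost satisfiesCost setCost
  repeat first
    | exact IsPoly.id
    | exact IsPoly.const _
    | apply IsPoly.add
    | apply IsPoly.mul

end PolynomialBounds

end CNFTheory

open CNFTheory in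
theorem mainTheorem1 :
    ∃ p : Polynomial ℕ, ∀ (α : Type) [DecidableEq α] (ρ : ChoiceRules α) (P : ListTheory α),
      IsHEF P.toTheory →
        (∀ M : List α, IsModel P.toTheory M.toFinset →
          (∃ (R : List α) (n : ℕ), (gea (xiHEF ρ) P M).Returns R n ∧
            IsMinimalModel P.toTheory R.toFinset ∧ R.toFinset ⊆ M.toFinset ∧
            n ≤ p.eval (P.size + M.length)) ∧
          (∃ (b : Bool) (n : ℕ), (checkMinimalModel ρ P M).Returns b n ∧
            (b = true ↔ IsMinimalModel P.toTheory M.toFinset) ∧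
            n ≤ p.eval (P.size + M.length))) ∧
        (IsPositive P.toTheory →
          ∃ (R : List α) (n : ℕ), (findMinimalModel ρ P).Returns R n ∧
            IsMinimalModel P.toTheory R.toFinset ∧ n ≤ p.eval P.size) := by
  obtain ⟨p, hp⟩ := isPoly_cost
  refine ⟨p, fun α _ ρ P hHEF => ⟨fun M hM => ⟨?_, ?_⟩, fun hpos => ?_⟩⟩
  -- The input size P.size + M.length is used as the common bound n for the theory and for the list.
  · obtain ⟨R, k, hR, hk, _, hmin, hsub⟩ :=
      gea_spec ρ hHEF (Nat.le_add_right P.size M.length) (Nat.le_add_left _ _) hM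
    exact ⟨R, k, hR, hmin, hsub, by rw [← hp]; dsimp only; omega⟩
  · obtain ⟨b, k, hb, hk, hiff⟩ :=
      checkMinimalModel_spec ρ hHEF (Nat.le_add_right P.size M.length) (Nat.le_add_left _ _) hM
    exact ⟨b, k, hb, hiff, by rw [← hp]; dsimp only; omega⟩
  · obtain ⟨R, k, hR, hk, hmin⟩ := findMinimalModel_spec ρ hHEF (le_refl P.size) hpos
    exact ⟨R, k, hR, hmin, by rw [← hp]; dsimp only; omega⟩
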